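/- Let $V$ be a finite set (the variables) and, for $i\in V$, let $A_i$ be a finite alphabet with at least two elements. Let $X_k=(X_k^{(i)})_{i\in V}$, $k=1,2,\dots$, be independent random vectors with common law $P$ on $\prod_{i\in V}A_i$, and let $M_k\in\{0,1\}^V$ be random, where $M_k^{(i)}=1$ means that the entry $X_k^{(i)}$ is observed and $M_k^{(i)}=0$ that it is missing; the process $(M_k)_k$ is independent of the process $(X_k)_k$ and otherwise arbitrary. Let $[i,j]_n$ be the set of $k\le n$ with $M_k^{(i)}=M_k^{(j)}=1$, and $n(i,j)$ its cardinality. For a finite alphabet $A$, hyperparameters $a(x)>0$ and a sequence over $A$ in which $x$ occurs $c(x)$ times, the Bayes measure is $$\frac{\Gamma(\sum_x a(x))}{\Gamma(\sum_x (c(x)+a(x)))}\prod_{x\in A}\frac{\Gamma(c(x)+a(x))}{\Gamma(a(x))}.$$ Fix positive hyperparameters on each $A_i$ and on each $A_i\times A_j$, the latter depending only on the unordered pair $\{i,j\}$. Let $Q^n_j(i)$, $Q^n_i(j)$, $Q^n(i,j)$ be the Bayes measures of $(X_k^{(i)})_{k\in[i,j]_n}$, $(X_k^{(j)})_{k\in[i,j]_n}$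 and $(X_k^{(i)},X_k^{(j)})_{k\in[i,j]_n}$, and $$K^n(i,j)=\frac1{n(i,j)}\log\frac{Q^n(i,j)}{Q^n_j(i)\,Q^n_i(j)} .$$ Assume that every value in $A_i$ has positive probability under $P$ for every $i\in V$, or that all hyperparameters equal $1/2$. The Chow–Liu algorithm with symmetric weights $w(i,j)$ starts with $E=\emptyset$ and $E'$ the set of all pairs $\{i,j\}$, $i\ne j$; until $E'$ is empty, it takes a pair of largest weight in $E'$ (ties broken arbitrarily), adds it to $E$ if its weight is positive and this creates no loop, and removes it from $E'$; it returns $E$. Say that $P$ factors along a forest $E$ on $V$ if $$P(x)=\prod_{i\in V}P(x_i)\prod_{\{i,j\}\in E}\frac{P(x_i,x_j)}{P(x_i)P(x_j)}\quad\text{for all }x,$$ and call $E$ a true forest of $P$ if, in addition, $P$ factors along no forest properly contained in $E$. Suppose that, for all $i\neq j$, $n(i,j)\to\infty$ as $n\to\infty$ with probability one. Then, with probability one, for all sufficiently large $n$ the Chow–Liu algorithm with the weights $K^n(i,j)$ has an output, and every output $E$ satisfies the following. 1. $E$ is also an output of the Chow–Liu algorithm with the true mutual informations $I(i,j)$ of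 $(X^{(i)},X^{(j)})$ as weights. 2. If $P$ factors along some forest, then $E$ is a true forest of $P$. 3. If $P$ has exactly one true forest $T$, then $E=T$. -/

import Mathlib

open MeasureTheory ProbabilityTheory Filter

namespace ForestLearning

noncomputable section

/-- Bayes measure of a sequence over the finite alphabet `A` in which each `x` occurs `c x` times,
for the Dirichlet prior with hyperparameters `a`. -/
def bayesMeasure {A : Type*} [Fintype A] (a : A → ℝ) (c : A → ℕ) : ℝ :=
  Real.Gamma (∑ x, a x) / Real.Gamma (∑ x, ((c x : ℝ) + a x)) *
    ∏ x, Real.Gamma ((c x : ℝ) + a x) / Real.Gamma (a x)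

section Data

variable {V : Type*} {A : V → Type*} [∀ i, Fintype (A i)] [∀ i, DecidableEq (A i)]

/-- The rows among the first `n` in which both entries `i` and `j` are observed;
`m k i = true` means that the entry `i` of row `k` is not missing. -/
def jointRows (m : ℕ → V → Bool) (n : ℕ) (i j : V) : Finset ℕ :=
  (Finset.range n).filter fun k => m k i = true ∧ m k j = true

/-- Bayes measure of the `i`-th entries of the rows in which `i` and `j` are both observed. -/
def bayesSingle (a : ∀ i, A i → ℝ) (x : ℕ → ∀ i, A i) (m : ℕ → V → Bool) (n : ℕ) (i j : V) : ℝ :=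
  bayesMeasure (a i) fun u => ((jointRows m n i j).filter fun k => x k i = u).card

/-- Bayes measure of the pairs of `i`-th and `j`-th entries of the rows in which both are
observed. -/
def bayesPair (b : ∀ i j, A i → A j → ℝ) (x : ℕ → ∀ i, A i) (m : ℕ → V → Bool) (n : ℕ)
    (i j : V) : ℝ :=
  bayesMeasure (fun u : A i × A j => b i j u.1 u.2) fun u =>
    ((jointRows m n i j).filter fun k => x k i = u.1 ∧ x k j = u.2).card

/-- The weight `K^n(i,j)`. -/
def weightK (a : ∀ i, A i → ℝ) (b : ∀ i j, A i → A j → ℝ) (x : ℕ → ∀ i, A i)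
    (m : ℕ → V → Bool) (n : ℕ) (i j : V) : ℝ :=
  1 / ((jointRows m n i j).card : ℝ) *
    Real.log (bayesPair b x m n i j / (bayesSingle a x m n i j * bayesSingle a x m n j i))

end Data

section Algorithm

variable {V : Type*} [Fintype V] [DecidableEq V]

/-- `ChowLiuState w E E'`: the algorithm with the symmetric weights `w` can reach the state in
which the edges in `E` have been added and the pairs in `E'` are still to be examined. In each
step a pair of largest weight in `E'` is removed from `E'`, and it is added to `E` if and only if
its weight is positive and no loop is created. Ties may be broken in any way. -/
inductive ChowLiuState (w : V → V → ℝ) : Finset (Sym2 V) → Finset (Sym2 V) → Prop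
  | init : ChowLiuState w ∅ (Finset.univ.filter fun e => ¬ e.IsDiag)
  | add {E E' : Finset (Sym2 V)} {i j : V} (h : ChowLiuState w E E') (hij : s(i, j) ∈ E')
      (hmax : ∀ k l, s(k, l) ∈ E' → w k l ≤ w i j)
      (hadd : 0 < w i j ∧ (SimpleGraph.fromEdgeSet (↑(insert s(i, j) E) : Set (Sym2 V))).IsAcyclic) :
      ChowLiuState w (insert s(i, j) E) (E'.erase s(i, j))
  | skip {E E' : Finset (Sym2 V)} {i j : V} (h : ChowLiuState w E E') (hij : s(i, j) ∈ E')
      (hmax : ∀ k l, s(k, l) ∈ E' → w k l ≤ w i j)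
      (hskip : ¬ (0 < w i j ∧
        (SimpleGraph.fromEdgeSet (↑(insert s(i, j) E) : Set (Sym2 V))).IsAcyclic)) :
      ChowLiuState w E (E'.erase s(i, j))

/-- `E` is an edge set that the algorithm with weights `w` can return. -/
def IsChowLiuOutput (w : V → V → ℝ) (E : Finset (Sym2 V)) : Prop :=
  ChowLiuState w E ∅

end Algorithm

section Model

variable {V : Type*} {A : V → Type*} [∀ i, MeasurableSpace (A i)]

/-- `P(X^(i) = u)`. -/
def marginal (P : Measure (∀ i, A i)) (i : V) (u : A i) : ℝ :=
  P.real {y | y i = u}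

/-- `P(X^(i) = u, X^(j) = v)`. -/
def pairMarginal (P : Measure (∀ i, A i)) (i j : V) (u : A i) (v : A j) : ℝ :=
  P.real {y | y i = u ∧ y j = v}

/-- The mutual information `I(i,j)`; terms with probability zero vanish. -/
def mutualInfo [∀ i, Fintype (A i)] (P : Measure (∀ i, A i)) (i j : V) : ℝ :=
  ∑ u : A i, ∑ v : A j, pairMarginal P i j u v *
    Real.log (pairMarginal P i j u v / (marginal P i u * marginal P j v))

/-- The factor `P(x_i, x_j) / (P(x_i) P(x_j))` of the unordered pair `{i, j}`. -/
def edgeFactor (P : Measure (∀ i, A i)) (x : ∀ i, A i) : Sym2 V → ℝ :=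
  Sym2.lift ⟨fun i j => pairMarginal P i j (x i) (x j) / (marginal P i (x i) * marginal P j (x j)),
    fun i j => by simp only [pairMarginal, and_comm, mul_comm]⟩

/-- `E` is a forest on `V`, and `P` is the distribution
`∏_{i ∈ V} P(x_i) ∏_{{i,j} ∈ E} P(x_i, x_j) / (P(x_i) P(x_j))`. -/
def FactorsAlongForest [Fintype V] (P : Measure (∀ i, A i)) (E : Finset (Sym2 V)) : Prop :=
  (∀ e ∈ E, ¬ e.IsDiag) ∧
  (SimpleGraph.fromEdgeSet (↑E : Set (Sym2 V))).IsAcyclic ∧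
  ∀ x : ∀ i, A i, P.real {x} = (∏ i, marginal P i (x i)) * ∏ e ∈ E, edgeFactor P x e

/-- A true forest of `P`: a forest along which `P` factors, without superfluous edges. -/
def IsTrueForest [Fintype V] (P : Measure (∀ i, A i)) (E : Finset (Sym2 V)) : Prop :=
  Minimal (FactorsAlongForest P) E

end Model

end

end ForestLearning

/-
An output of the Chow–Liu algorithm depends only on the order and the signs of the weights, so it
suffices that almost surely the weights `K^n(i,j)` converge to `I(i,j)` and are eventually
nonpositive where `I(i,j) = 0`.

By Stirling's formula, the logarithm of the Bayes factor of a contingency table with `N`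
observations is the sample size times the empirical mutual information, plus a penalty of order
`log N`, plus `O(1)`. Dividing by `N` gives the convergence. Under independence, the information
is at most the `χ²` distance to the product law, hence `o(log N)` because the counts deviate from
their means by `o(√(N log N))`, and the penalty `-(|A_i| - 1)(|A_j| - 1)/2 · log N` wins. A value of
probability zero disturbs the penalty unless its hyperparameters are `1/2`.

For the true mutual informations, the algorithm is greedy and returns a forest of maximal total
weight. The relative entropy of `P` to the forest distribution of `E` is
`D(P ‖ ∏ P(x_i)) - ∑_{e ∈ E} I(e)`, which vanishes if and only if `P` factors along `E`. If `P`
factors along some forest, it therefore factors along the maximal one, and as every edge of the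
latter has positive weight, none of its proper subforests attains the same total.
-/

namespace ForestLearning

section Forest

variable {V : Type*} {E T : Finset (Sym2 V)}

/-- `E` is the edge set of a forest: it contains no loop at a single vertex and no cycle. -/
def IsForest (E : Finset (Sym2 V)) : Prop :=
  (∀ e ∈ E, ¬ e.IsDiag) ∧ (SimpleGraph.fromEdgeSet (E : Set (Sym2 V))).IsAcyclic

lemma fromEdgeSet_mono (h : E ⊆ T) :
    SimpleGraph.fromEdgeSet (E : Set (Sym2 V)) ≤ SimpleGraph.fromEdgeSet (T : Set (Sym2 V)) :=
  SimpleGraph.fromEdgeSet_mono (Finset.coe_subset.mpr h)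

lemma IsForest.mono (hT : IsForest T) (h : E ⊆ T) : IsForest E :=
  ⟨fun e he => hT.1 e (h he), hT.2.anti (fromEdgeSet_mono h)⟩

lemma mem_of_mem_edges {i j : V} {p : (SimpleGraph.fromEdgeSet (E : Set (Sym2 V))).Walk i j}
    {e : Sym2 V} (he : e ∈ p.edges) : e ∈ E := by
  have h := p.edges_subset_edgeSet he
  rw [SimpleGraph.edgeSet_fromEdgeSet] at h
  exact h.1

lemma exists_mem_edges_notMem {i j : V}
    (hE : ¬ (SimpleGraph.fromEdgeSet (E : Set (Sym2 V))).Reachable i j)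
    (p : (SimpleGraph.fromEdgeSet (T : Set (Sym2 V))).Walk i j) : ∃ e ∈ p.edges, e ∉ E := by
  by_contra! hpE
  refine hE ⟨p.transfer _ fun e he => ?_⟩
  have hmem := p.edges_subset_edgeSet he
  rw [SimpleGraph.edgeSet_fromEdgeSet] at hmem ⊢
  exact ⟨hpE e he, hmem.2⟩

lemma exists_leaf {G : SimpleGraph V} [Finite G.edgeSet] (hG : G.IsAcyclic) {u v : V}
    (huv : G.Adj u v) : ∃ x y, G.Adj x y ∧ ∀ z, G.Adj x z → z = y := by
  have : Nonempty V := ⟨u⟩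
  obtain ⟨x, y, p, hp, hmax⟩ := SimpleGraph.Walk.exists_isPath_forall_isPath_length_le_length G
  have hpos : 0 < p.length :=
    Nat.lt_of_lt_of_le Nat.one_pos (hmax u v huv.toWalk (SimpleGraph.Walk.IsPath.of_adj huv))
  have hnil : ¬ p.Nil := fun h => hpos.ne' (SimpleGraph.Walk.length_eq_zero_iff.mpr h)
  refine ⟨x, p.snd, p.adj_snd hnil, fun z hz => hG.eq_snd_of_adj_start hp hz ?_⟩
  by_contra hzp
  have hlong := hmax z y (p.cons hz.symm) (hp.cons hzp)
  rw [SimpleGraph.Walk.length_cons] at hlong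
  lia

variable [DecidableEq V] {E' S : Finset (Sym2 V)} {W : Sym2 V → ℝ}

lemma isForest_insert_iff {i j : V} (hij : s(i, j) ∉ E) :
    IsForest (insert s(i, j) E) ↔
      i ≠ j ∧ IsForest E ∧ ¬ (SimpleGraph.fromEdgeSet (E : Set (Sym2 V))).Reachable i j := by
  have hsup : SimpleGraph.fromEdgeSet (↑(insert s(i, j) E) : Set (Sym2 V)) =
      SimpleGraph.fromEdgeSet (E : Set (Sym2 V)) ⊔ SimpleGraph.edge i j := by
    rw [SimpleGraph.edge, ← SimpleGraph.fromEdgeSet_union, Finset.coe_insert, Set.insert_eq,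
      Set.union_comm]
  have hadj : ¬ (SimpleGraph.fromEdgeSet (E : Set (Sym2 V))).Adj i j := by simp [hij]
  rw [IsForest, hsup, SimpleGraph.isAcyclic_sup_fromEdgeSet_iff, Finset.forall_mem_insert, IsForest,
    Sym2.mk_isDiag_iff]
  tauto

lemma IsForest.not_reachable_erase (hT : IsForest T) {i j : V} {e : Sym2 V}
    {p : (SimpleGraph.fromEdgeSet (T : Set (Sym2 V))).Walk i j} (hp : p.IsPath)
    (he : e ∈ p.edges) :
    ¬ (SimpleGraph.fromEdgeSet (↑(T.erase e) : Set (Sym2 V))).Reachable i j := by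
  intro h
  obtain ⟨q, hq⟩ := h.exists_isPath
  have hle := fromEdgeSet_mono (T.erase_subset e)
  have hpq : p = q.mapLe hle :=
    congrArg Subtype.val ((hT.2.subsingleton_path i j).elim ⟨p, hp⟩ ⟨q.mapLe hle, hq.mapLe hle⟩)
  have heq : e ∈ q.edges := by simpa [hpq] using he
  exact T.notMem_erase e (mem_of_mem_edges heq)

lemma IsForest.exists_exchange {e : Sym2 V} (hT : IsForest T) (hE : IsForest (insert e E))
    (he : e ∉ E) (hTe : ¬ IsForest (insert e T)) :
    ∃ f ∈ T, f ∉ E ∧ IsForest (insert e (T.erase f)) := by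
  induction e with | h i j
  have heT : s(i, j) ∉ T := fun h => hTe (by rwa [Finset.insert_eq_self.mpr h])
  obtain ⟨hij, -, hEij⟩ := (isForest_insert_iff he).mp hE
  have hTij : (SimpleGraph.fromEdgeSet (T : Set (Sym2 V))).Reachable i j := by
    by_contra h
    exact hTe ((isForest_insert_iff heT).mpr ⟨hij, hT, h⟩)
  obtain ⟨p, hp⟩ := hTij.exists_isPath
  obtain ⟨f, hfp, hfE⟩ := exists_mem_edges_notMem hEij p
  exact ⟨f, mem_of_mem_edges hfp, hfE,
    (isForest_insert_iff fun h => heT (Finset.mem_of_mem_erase h)).mpr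
      ⟨hij, hT.mono (T.erase_subset f), hT.not_reachable_erase hp hfp⟩⟩

lemma IsForest.exists_leaf_edge (hE : IsForest E) (hne : E.Nonempty) :
    ∃ x y, x ≠ y ∧ s(x, y) ∈ E ∧ ∀ e ∈ E.erase s(x, y), x ∉ e := by
  obtain ⟨e, he⟩ := hne
  induction e with | h u v
  have huv : (SimpleGraph.fromEdgeSet (E : Set (Sym2 V))).Adj u v :=
    (SimpleGraph.fromEdgeSet_adj _).mpr ⟨he, hE.1 _ he⟩
  have : Finite (SimpleGraph.fromEdgeSet (E : Set (Sym2 V))).edgeSet := by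
    rw [SimpleGraph.edgeSet_fromEdgeSet]
    exact (E.finite_toSet.subset Set.sdiff_subset).to_subtype
  obtain ⟨x, y, hxy, hleaf⟩ := exists_leaf hE.2 huv
  rw [SimpleGraph.fromEdgeSet_adj] at hxy
  refine ⟨x, y, hxy.2, hxy.1, fun e he hx => ?_⟩
  obtain ⟨z, rfl⟩ := hx
  have hz := Finset.mem_of_mem_erase he
  have hzy : z = y := hleaf z ((SimpleGraph.fromEdgeSet_adj _).mpr ⟨hz, hE.1 _ hz⟩)
  exact Finset.notMem_erase _ _ (hzy ▸ he)

lemma IsForest.exists_heavier_of_insert (hS : IsForest S) (hES : E ⊆ S) (hSE : S ⊆ E ∪ E')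
    {e : Sym2 V} (he : e ∉ E) (hE : IsForest (insert e E)) (hpos : 0 ≤ W e)
    (hmax : ∀ f ∈ E', W f ≤ W e) :
    ∃ S', insert e E ⊆ S' ∧ S' ⊆ insert e E ∪ E'.erase e ∧ IsForest S' ∧
      ∑ f ∈ S, W f ≤ ∑ f ∈ S', W f := by
  by_cases heS : e ∈ S
  · exact ⟨S, Finset.insert_subset heS hES, by grind, hS, le_rfl⟩
  by_cases hins : IsForest (insert e S)
  · refine ⟨insert e S, Finset.insert_subset_insert e hES, by grind, hins, ?_⟩
    rw [Finset.sum_insert heS]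
    exact le_add_of_nonneg_left hpos
  · obtain ⟨f, hfS, hfE, hf⟩ := hS.exists_exchange hE he hins
    refine ⟨insert e (S.erase f), by grind, by grind, hf, ?_⟩
    rw [Finset.sum_insert (by grind), ← Finset.add_sum_erase S W hfS]
    gcongr
    exact hmax f (by grind)

lemma IsForest.exists_heavier_of_skip (hS : IsForest S) (hES : E ⊆ S) (hSE : S ⊆ E ∪ E')
    {e : Sym2 V} (he : e ∉ E) (hskip : ¬ (0 < W e ∧ IsForest (insert e E))) :
    ∃ S', E ⊆ S' ∧ S' ⊆ E ∪ E'.erase e ∧ IsForest S' ∧ ∑ f ∈ S, W f ≤ ∑ f ∈ S', W f := by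
  by_cases heS : e ∈ S
  · have hneg : W e ≤ 0 := by
      by_contra! hpos
      exact hskip ⟨hpos, hS.mono (Finset.insert_subset heS hES)⟩
    refine ⟨S.erase e, by grind, by grind, hS.mono (S.erase_subset e), ?_⟩
    rw [← Finset.add_sum_erase S W heS]
    exact add_le_of_nonpos_left hneg
  · exact ⟨S, hES, by grind, hS, le_rfl⟩

end Forest

section Algorithm

lemma exists_mem_forall_weight_le {V : Type*} [Finite V] (w : V → V → ℝ) {E' : Finset (Sym2 V)}
    (hE' : E'.Nonempty) : ∃ i j, s(i, j) ∈ E' ∧ ∀ k l, s(k, l) ∈ E' → w k l ≤ w i j := by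
  obtain ⟨e, he⟩ := hE'
  induction e with | h i j
  obtain ⟨⟨k, l⟩, hkl, hmax⟩ := Set.exists_max_image {p : V × V | s(p.1, p.2) ∈ E'}
    (fun p => w p.1 p.2) (Set.toFinite _) ⟨(i, j), he⟩
  exact ⟨k, l, hkl, fun k' l' h => hmax (k', l') h⟩

variable {V : Type*} [Fintype V] [DecidableEq V] {w w' : V → V → ℝ} {W : Sym2 V → ℝ}
  {E E' T : Finset (Sym2 V)}

lemma ChowLiuState.not_isDiag_of_mem_remaining (h : ChowLiuState w E E') :
    ∀ e ∈ E', ¬ e.IsDiag := by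
  induction h with
  | init => simp
  | add _ _ _ _ ih => exact fun e he => ih e (Finset.mem_of_mem_erase he)
  | skip _ _ _ _ ih => exact fun e he => ih e (Finset.mem_of_mem_erase he)

lemma ChowLiuState.ne_of_mem_remaining (h : ChowLiuState w E E') {i j : V} (hij : s(i, j) ∈ E') :
    i ≠ j :=
  h.not_isDiag_of_mem_remaining _ hij

lemma ChowLiuState.isForest (h : ChowLiuState w E E') : IsForest E := by
  induction h with
  | init => simp [IsForest]
  | add h hij _ hadd ih =>
    exact ⟨(Finset.forall_mem_insert _ _ _).mpr ⟨h.not_isDiag_of_mem_remaining _ hij, ih.1⟩,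
      hadd.2⟩
  | skip _ _ _ _ ih => exact ih

lemma ChowLiuState.disjoint (h : ChowLiuState w E E') : Disjoint E E' := by
  induction h with
  | init => simp
  | @add E E' i j _ _ _ _ ih =>
    exact Finset.disjoint_insert_left.mpr
      ⟨Finset.notMem_erase _ _, ih.mono_right (Finset.erase_subset _ _)⟩
  | skip _ _ _ _ ih => exact ih.mono_right (Finset.erase_subset _ _)

lemma ChowLiuState.weight_pos (hW : ∀ i j, W s(i, j) = w i j) (h : ChowLiuState w E E') :
    ∀ e ∈ E, 0 < W e := by
  induction h with
  | init => simp
  | add _ _ _ hadd ih => exact (Finset.forall_mem_insert _ _ _).mpr ⟨(hW _ _).symm ▸ hadd.1, ih⟩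
  | skip _ _ _ _ ih => exact ih

lemma ChowLiuState.exists_isChowLiuOutput (h : ChowLiuState w E E') :
    ∃ F, IsChowLiuOutput w F := by
  induction hn : E'.card generalizing E E' with
  | zero =>
    obtain rfl := Finset.card_eq_zero.mp hn
    exact ⟨E, h⟩
  | succ n ih =>
    obtain ⟨i, j, hij, hmax⟩ :=
      exists_mem_forall_weight_le w (E' := E') (Finset.card_pos.mp (by lia))
    have hcard : (E'.erase s(i, j)).card = n := by rw [Finset.card_erase_of_mem hij, hn]; rfl
    by_cases hadd : 0 < w i j ∧
        (SimpleGraph.fromEdgeSet (↑(insert s(i, j) E) : Set (Sym2 V))).IsAcyclic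
    · exact ih (h.add hij hmax hadd) hcard
    · exact ih (h.skip hij hmax hadd) hcard

lemma exists_isChowLiuOutput (w : V → V → ℝ) : ∃ E, IsChowLiuOutput w E :=
  ChowLiuState.init.exists_isChowLiuOutput

lemma ChowLiuState.exists_heavier (hW : ∀ i j, W s(i, j) = w i j) (hT : IsForest T)
    (h : ChowLiuState w E E') :
    ∃ S, E ⊆ S ∧ S ⊆ E ∪ E' ∧ IsForest S ∧ ∑ e ∈ T, W e ≤ ∑ e ∈ S, W e := by
  induction h with
  | init => exact ⟨T, by simp, fun e he => by simpa using hT.1 e he, hT, le_rfl⟩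
  | @add E E' i j h hij hmax hadd ih =>
    obtain ⟨S, hES, hSE, hS, hTS⟩ := ih
    have hmax' : ∀ f ∈ E', W f ≤ W s(i, j) := fun f hf => by
      induction f with | h k l
      simpa only [hW] using hmax k l hf
    obtain ⟨S', hES', hSE', hS', hSS'⟩ := hS.exists_heavier_of_insert hES hSE
      (Finset.disjoint_right.mp h.disjoint hij) (h.add hij hmax hadd).isForest
      ((hW i j).symm ▸ hadd.1.le) hmax'
    exact ⟨S', hES', hSE', hS', hTS.trans hSS'⟩
  | @skip E E' i j h hij _ hskip ih =>
    obtain ⟨S, hES, hSE, hS, hTS⟩ := ih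
    obtain ⟨S', hES', hSE', hS', hSS'⟩ := hS.exists_heavier_of_skip hES hSE
      (Finset.disjoint_right.mp h.disjoint hij) (fun hc => hskip ⟨hW i j ▸ hc.1, hc.2.2⟩)
    exact ⟨S', hES', hSE', hS', hTS.trans hSS'⟩

lemma IsChowLiuOutput.sum_le (hW : ∀ i j, W s(i, j) = w i j) (h : IsChowLiuOutput w E)
    (hT : IsForest T) : ∑ e ∈ T, W e ≤ ∑ e ∈ E, W e := by
  obtain ⟨S, hES, hSE, -, hTS⟩ := ChowLiuState.exists_heavier hW hT h
  rw [Finset.union_empty] at hSE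
  rwa [hES.antisymm hSE]

lemma ChowLiuState.of_lt_imp_lt
    (hlt : ∀ i j k l, i ≠ j → k ≠ l → w' i j < w' k l → w i j < w k l)
    (hpos : ∀ i j, i ≠ j → (0 < w i j ↔ 0 < w' i j)) (h : ChowLiuState w E E') :
    ChowLiuState w' E E' := by
  have hmax' {E E' : Finset (Sym2 V)} (h : ChowLiuState w E E') {i j : V} (hij : s(i, j) ∈ E')
      (hmax : ∀ k l, s(k, l) ∈ E' → w k l ≤ w i j) (k l : V) (hkl : s(k, l) ∈ E') :
      w' k l ≤ w' i j := by
    by_contra! hcon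
    exact (hmax k l hkl).not_gt
      (hlt i j k l (h.ne_of_mem_remaining hij) (h.ne_of_mem_remaining hkl) hcon)
  induction h with
  | init => exact .init
  | add h hij hmax hadd ih =>
    exact ih.add hij (hmax' h hij hmax)
      ⟨(hpos _ _ (h.ne_of_mem_remaining hij)).mp hadd.1, hadd.2⟩
  | skip h hij hmax hskip ih =>
    exact ih.skip hij (hmax' h hij hmax) fun hadd =>
      hskip ⟨(hpos _ _ (h.ne_of_mem_remaining hij)).mpr hadd.1, hadd.2⟩

lemma eventually_isChowLiuOutput_of_tendsto {ι : Type*} {l : Filter ι} {w : ι → V → V → ℝ}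
    {w₀ : V → V → ℝ} (htend : ∀ i j, i ≠ j → Tendsto (w · i j) l (nhds (w₀ i j)))
    (hnonpos : ∀ i j, i ≠ j → w₀ i j ≤ 0 → ∀ᶠ n in l, w n i j ≤ 0) :
    ∀ᶠ n in l, ∀ E, IsChowLiuOutput (w n) E → IsChowLiuOutput w₀ E := by
  have hlt : ∀ᶠ n in l, ∀ i j k m, i ≠ j → k ≠ m → w₀ i j < w₀ k m → w n i j < w n k m := by
    simp only [eventually_all]
    exact fun i j k m hij hkm h => (htend i j hij).eventually_lt (htend k m hkm) h
  have hpos : ∀ᶠ n in l, ∀ i j, i ≠ j → (0 < w n i j ↔ 0 < w₀ i j) := by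
    simp only [eventually_all]
    intro i j hij
    rcases lt_or_ge 0 (w₀ i j) with h₀ | h₀
    · filter_upwards [(htend i j hij).eventually_const_lt h₀] with n hn
      exact iff_of_true hn h₀
    · filter_upwards [hnonpos i j hij h₀] with n hn
      exact iff_of_false hn.not_gt h₀.not_gt
  filter_upwards [hlt, hpos] with n hlt hpos E hE
  exact ChowLiuState.of_lt_imp_lt hlt hpos hE

end Algorithm

section RelativeEntropy

variable {ι : Type*} [Fintype ι] {p q : ι → ℝ}

/-- The relative entropy `D(p ‖ q)` of two weights on a finite type, not necessarily of total
mass one. It is the usual one only if `p x = 0` whenever `q x = 0`: otherwise the infinite terms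
are replaced by zero. -/
noncomputable def relEntropy (p q : ι → ℝ) : ℝ :=
  ∑ x, p x * Real.log (p x / q x)

lemma relEntropy_self (p : ι → ℝ) : relEntropy p p = 0 := by
  refine Finset.sum_eq_zero fun x _ => ?_
  rcases eq_or_ne (p x) 0 with h | h
  · rw [h, zero_mul]
  · rw [div_self h, Real.log_one, mul_zero]

lemma relEntropy_eq_sum_negMulLog (hpq : ∀ x, q x = 0 → p x = 0) :
    relEntropy p q = -∑ x, Real.negMulLog (p x) - ∑ x, p x * Real.log (q x) := by
  rw [relEntropy, ← Finset.sum_neg_distrib, ← Finset.sum_sub_distrib]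
  refine Finset.sum_congr rfl fun x _ => ?_
  rcases eq_or_ne (p x) 0 with h | h
  · simp [h]
  · rw [Real.log_div h fun hq => h (hpq x hq), Real.negMulLog]
    ring

lemma relEntropy_eq_sum_klFun (hpq : ∀ x, q x = 0 → p x = 0) :
    relEntropy p q =
      ∑ x, q x * InformationTheory.klFun (p x / q x) + (∑ x, p x - ∑ x, q x) := by
  rw [relEntropy, ← Finset.sum_sub_distrib, ← Finset.sum_add_distrib]
  refine Finset.sum_congr rfl fun x _ => ?_
  rcases eq_or_ne (q x) 0 with h | h
  · simp [h, hpq x h]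
  · rw [InformationTheory.klFun_apply]
    field_simp
    ring

lemma relEntropy_nonneg (hp : ∀ x, 0 ≤ p x) (hq : ∀ x, 0 ≤ q x) (hpq : ∀ x, q x = 0 → p x = 0)
    (hsum : ∑ x, q x ≤ ∑ x, p x) : 0 ≤ relEntropy p q := by
  rw [relEntropy_eq_sum_klFun hpq]
  exact add_nonneg (Finset.sum_nonneg fun x _ => mul_nonneg (hq x)
    (InformationTheory.klFun_nonneg (div_nonneg (hp x) (hq x)))) (sub_nonneg.mpr hsum)

lemma eq_of_relEntropy_nonpos (hp : ∀ x, 0 ≤ p x) (hq : ∀ x, 0 ≤ q x)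
    (hpq : ∀ x, q x = 0 → p x = 0) (hsum : ∑ x, q x ≤ ∑ x, p x) (hD : relEntropy p q ≤ 0) :
    p = q := by
  have hterm : ∀ x ∈ Finset.univ, 0 ≤ q x * InformationTheory.klFun (p x / q x) := fun x _ =>
    mul_nonneg (hq x) (InformationTheory.klFun_nonneg (div_nonneg (hp x) (hq x)))
  rw [relEntropy_eq_sum_klFun hpq] at hD
  have hzero : ∑ x, q x * InformationTheory.klFun (p x / q x) = 0 :=
    le_antisymm (by linarith) (Finset.sum_nonneg hterm)
  funext x
  rcases eq_or_ne (q x) 0 with h | h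
  · rw [h, hpq x h]
  · have hkl := ((Finset.sum_eq_zero_iff_of_nonneg hterm).mp hzero x (Finset.mem_univ x))
    rw [mul_eq_zero, or_iff_right h,
      InformationTheory.klFun_eq_zero_iff (div_nonneg (hp x) (hq x))] at hkl
    exact (div_eq_one_iff_eq h).mp hkl

lemma relEntropy_le_chiSq (hp : ∀ x, 0 ≤ p x) (hq : ∀ x, 0 ≤ q x)
    (hpq : ∀ x, q x = 0 → p x = 0) (hsum : ∑ x, p x ≤ ∑ x, q x) :
    relEntropy p q ≤ ∑ x, (p x - q x) ^ 2 / q x := by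
  suffices relEntropy p q ≤ ∑ x, ((p x - q x) ^ 2 / q x + (p x - q x)) by
    rw [Finset.sum_add_distrib, Finset.sum_sub_distrib] at this
    linarith
  refine Finset.sum_le_sum fun x _ => ?_
  rcases (hq x).eq_or_lt with h | h
  · simp [← h, hpq x h.symm]
  rcases (hp x).eq_or_lt with h' | h'
  · rw [← h', zero_mul, zero_sub, neg_sq, sq, mul_div_cancel_right₀ _ h.ne', add_neg_cancel]
  calc p x * Real.log (p x / q x) ≤ p x * (p x / q x - 1) := by
        gcongr
        exact Real.log_le_sub_one_of_pos (div_pos h' h)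
    _ = (p x - q x) ^ 2 / q x + (p x - q x) := by field_simp; ring

end RelativeEntropy

section TableInfo

variable {α β : Type*} [Fintype α] [Fintype β] {p : α → β → ℝ} {q : α → ℝ} {q' : β → ℝ}

/-- The mutual information of the table `p`, extended to a homogeneous function of tables of
arbitrary total mass: for a contingency table `p` it is the sample size times the empirical mutual
information. -/
noncomputable def tableInfo (p : α → β → ℝ) : ℝ :=
  ∑ u, Real.negMulLog (∑ v, p u v) + ∑ v, Real.negMulLog (∑ u, p u v) -
    ∑ u, ∑ v, Real.negMulLog (p u v) - Real.negMulLog (∑ u, ∑ v, p u v)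

lemma continuous_tableInfo : Continuous (tableInfo : (α → β → ℝ) → ℝ) := by
  unfold tableInfo
  fun_prop

lemma tableInfo_mul (t : ℝ) (p : α → β → ℝ) :
    tableInfo (fun u v => t * p u v) = t * tableInfo p := by
  have hcomm : ∑ v, ∑ u, p u v = ∑ u, ∑ v, p u v := Finset.sum_comm
  simp only [tableInfo, ← Finset.mul_sum, Real.negMulLog_mul, Finset.sum_add_distrib,
    ← Finset.sum_mul, hcomm]
  ring

lemma relEntropy_product {N : ℝ} (hN : ∑ u, ∑ v, p u v = N) (hN0 : N ≠ 0)
    (hp : ∀ u v, q u * q' v = 0 → p u v = 0) :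
    relEntropy (fun z : α × β => p z.1 z.2) (fun z => N * (q z.1 * q' z.2)) =
      tableInfo p + relEntropy (fun u => ∑ v, p u v) (fun u => N * q u) +
        relEntropy (fun v => ∑ u, p u v) (fun v => N * q' v) := by
  have hrow (u : α) (hu : N * q u = 0) : ∑ v, p u v = 0 :=
    Finset.sum_eq_zero fun v _ => hp u v (by simp_all)
  have hcol (v : β) (hv : N * q' v = 0) : ∑ u, p u v = 0 :=
    Finset.sum_eq_zero fun u _ => hp u v (by simp_all)
  have hprod (z : α × β) (hz : N * (q z.1 * q' z.2) = 0) : p z.1 z.2 = 0 :=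
    hp z.1 z.2 ((mul_eq_zero.mp hz).resolve_left hN0)
  have hlog (u : α) (v : β) : p u v * Real.log (N * (q u * q' v)) =
      p u v * Real.log (N * q u) + p u v * Real.log (N * q' v) - p u v * Real.log N := by
    rcases eq_or_ne (q u * q' v) 0 with h | h
    · simp [hp u v h]
    · have hu := left_ne_zero_of_mul h
      have hv := right_ne_zero_of_mul h
      rw [Real.log_mul hN0 h, Real.log_mul hu hv, Real.log_mul hN0 hu, Real.log_mul hN0 hv]
      ring
  have hcross : ∑ z : α × β, p z.1 z.2 * Real.log (N * (q z.1 * q' z.2)) =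
      ∑ u, (∑ v, p u v) * Real.log (N * q u) + ∑ v, (∑ u, p u v) * Real.log (N * q' v) +
        Real.negMulLog N := by
    have hcomm : ∑ u, ∑ v, p u v * Real.log (N * q' v) =
        ∑ v, ∑ u, p u v * Real.log (N * q' v) := Finset.sum_comm
    simp only [Fintype.sum_prod_type, hlog, Finset.sum_add_distrib, Finset.sum_sub_distrib, hcomm,
      ← Finset.sum_mul, hN, Real.negMulLog]
    ring
  rw [relEntropy_eq_sum_negMulLog hrow, relEntropy_eq_sum_negMulLog hcol,
    relEntropy_eq_sum_negMulLog hprod, hcross, tableInfo, hN, Fintype.sum_prod_type]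
  ring

lemma tableInfo_eq_relEntropy (hp0 : ∀ u v, 0 ≤ p u v) (hp1 : ∑ u, ∑ v, p u v = 1) :
    tableInfo p =
      relEntropy (fun z : α × β => p z.1 z.2) (fun z => (∑ v, p z.1 v) * ∑ u, p u z.2) := by
  have h := relEntropy_product (q := fun u => ∑ v, p u v) (q' := fun v => ∑ u, p u v) hp1
    one_ne_zero fun u v huv => by
      rcases mul_eq_zero.mp huv with h | h
      · exact (Finset.sum_eq_zero_iff_of_nonneg fun v _ => hp0 u v).mp h v (Finset.mem_univ v)
      · exact (Finset.sum_eq_zero_iff_of_nonneg fun u _ => hp0 u v).mp h u (Finset.mem_univ u)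
  simpa only [one_mul, relEntropy_self, add_zero] using h.symm

lemma tableInfo_le_chiSq {N : ℝ} (hp0 : ∀ u v, 0 ≤ p u v) (hN : ∑ u, ∑ v, p u v = N)
    (hN0 : 0 < N) (hq : ∀ u, 0 ≤ q u) (hq' : ∀ v, 0 ≤ q' v) (hq1 : ∑ u, q u = 1)
    (hq1' : ∑ v, q' v = 1) (hp : ∀ u v, q u * q' v = 0 → p u v = 0) :
    tableInfo p ≤ ∑ u, ∑ v, (p u v - N * (q u * q' v)) ^ 2 / (N * (q u * q' v)) := by
  have hD := relEntropy_product hN hN0.ne' hp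
  have hrow : 0 ≤ relEntropy (fun u => ∑ v, p u v) (fun u => N * q u) := by
    refine relEntropy_nonneg (fun u => Finset.sum_nonneg fun v _ => hp0 u v)
      (fun u => mul_nonneg hN0.le (hq u)) (fun u hu => Finset.sum_eq_zero fun v _ => hp u v ?_) ?_
    · rw [(mul_eq_zero.mp hu).resolve_left hN0.ne', zero_mul]
    · rw [← Finset.mul_sum, hq1, mul_one, hN]
  have hcol : 0 ≤ relEntropy (fun v => ∑ u, p u v) (fun v => N * q' v) := by
    refine relEntropy_nonneg (fun v => Finset.sum_nonneg fun u _ => hp0 u v)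
      (fun v => mul_nonneg hN0.le (hq' v)) (fun v hv => Finset.sum_eq_zero fun u _ => hp u v ?_) ?_
    · rw [(mul_eq_zero.mp hv).resolve_left hN0.ne', mul_zero]
    · rw [← Finset.mul_sum, hq1', mul_one, Finset.sum_comm, hN]
  have hchi : relEntropy (fun z : α × β => p z.1 z.2) (fun z => N * (q z.1 * q' z.2)) ≤
      ∑ z : α × β, (p z.1 z.2 - N * (q z.1 * q' z.2)) ^ 2 / (N * (q z.1 * q' z.2)) := by
    refine relEntropy_le_chiSq (fun z => hp0 _ _)
      (fun z => mul_nonneg hN0.le (mul_nonneg (hq _) (hq' _)))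
      (fun z hz => hp _ _ ((mul_eq_zero.mp hz).resolve_left hN0.ne')) ?_
    simp only [Fintype.sum_prod_type, ← Finset.mul_sum, hq1', mul_one, hq1, hN, le_refl]
  rw [Fintype.sum_prod_type] at hchi
  linarith

end TableInfo

section Stirling

open Asymptotics

lemma tendsto_log_Gamma_nat_add_sub_log_factorial {a : ℝ} (ha : 0 < a) :
    Tendsto (fun n : ℕ => Real.log (Real.Gamma (n + a)) -
      ((a - 1) * Real.log n + Real.log n.factorial)) atTop (nhds 0) := by
  have hseq : Tendsto (fun n : ℕ => Real.log (Real.Gamma a) - Real.BohrMollerup.logGammaSeq a n)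
      atTop (nhds 0) := by
    simpa using (Real.BohrMollerup.tendsto_log_gamma ha).const_sub (Real.log (Real.Gamma a))
  have hratio : Tendsto (fun n : ℕ => Real.log (1 + a / n)) atTop (nhds 0) := by
    simpa using ((tendsto_const_div_atTop_nhds_zero_nat a).const_add 1).log (by simp)
  rw [← sub_zero (0 : ℝ)]
  refine (hseq.sub hratio).congr' ?_
  filter_upwards [eventually_gt_atTop 0] with n hn
  have hn : (0 : ℝ) < n := Nat.cast_pos.mpr hn
  have hna : 0 < (n : ℝ) + a := by positivity
  have hlog {y : ℝ} (hy : 0 < y) :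
      Real.log (Real.Gamma (y + 1)) = Real.log (Real.Gamma y) + Real.log y := by
    rw [Real.Gamma_add_one hy.ne', Real.log_mul hy.ne' (Real.Gamma_pos_of_pos hy).ne', add_comm]
  have hsum : Real.log (Real.Gamma (a + (n + 1 : ℕ))) = Real.log (Real.Gamma a) +
      ∑ m ∈ Finset.range (n + 1), Real.log (a + m) :=
    Real.BohrMollerup.f_add_nat_eq (f := Real.log ∘ Real.Gamma) hlog ha (n + 1)
  have hsucc : Real.log (Real.Gamma (a + (n + 1 : ℕ))) =
      Real.log (Real.Gamma (n + a)) + Real.log (n + a) := by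
    rw [← hlog hna]
    push_cast
    ring_nf
  have hdiv : Real.log (1 + a / n) = Real.log (n + a) - Real.log n := by
    rw [← Real.log_div hna.ne' hn.ne', add_div, div_self hn.ne']
  rw [Real.BohrMollerup.logGammaSeq, hdiv]
  linarith

lemma isBigO_log_factorial :
    (fun n : ℕ => Real.log n.factorial - (n * Real.log n - n + 1 / 2 * Real.log n))
      =O[atTop] fun _ => (1 : ℝ) := by
  have hlim := (Stirling.tendsto_stirlingSeq_sqrt_pi.log (by positivity)).add_const
    (1 / 2 * Real.log 2)
  refine (hlim.isBigO_one ℝ).congr' ?_ .rfl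
  filter_upwards [eventually_gt_atTop 0] with n hn
  have hn : (n : ℝ) ≠ 0 := Nat.cast_ne_zero.mpr hn.ne'
  rw [Stirling.log_stirlingSeq_formula, Real.log_mul two_ne_zero hn,
    Real.log_div hn (Real.exp_ne_zero 1), Real.log_exp]
  ring

lemma isBigO_log_Gamma_nat_add {a : ℝ} (ha : 0 < a) :
    (fun n : ℕ => Real.log (Real.Gamma (n + a)) -
      (n * Real.log n - n + (a - 1 / 2) * Real.log n)) =O[⊤] fun _ => (1 : ℝ) := by
  refine IsBigO.nat_of_atTop ?_ (.of_forall fun n h => absurd h one_ne_zero)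
  refine (((tendsto_log_Gamma_nat_add_sub_log_factorial ha).isBigO_one ℝ).add
    isBigO_log_factorial).congr_left fun n => ?_
  ring

end Stirling

section BayesMeasure

open Asymptotics

variable {α : Type*} [Fintype α] {a : α → ℝ}

lemma sum_natCast_add (a : α → ℝ) (c : α → ℕ) :
    ∑ x, ((c x : ℝ) + a x) = (∑ x, c x : ℕ) + ∑ x, a x := by
  rw [Finset.sum_add_distrib, Nat.cast_sum]

lemma bayesMeasure_pos [Nonempty α] (ha : ∀ x, 0 < a x) (c : α → ℕ) : 0 < bayesMeasure a c := by
  have hca (x : α) : 0 < (c x : ℝ) + a x := add_pos_of_nonneg_of_pos (Nat.cast_nonneg _) (ha x)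
  have hGamma {f : α → ℝ} (hf : ∀ x, 0 < f x) : 0 < Real.Gamma (∑ x, f x) :=
    Real.Gamma_pos_of_pos (Finset.sum_pos (fun x _ => hf x) Finset.univ_nonempty)
  exact mul_pos (div_pos (hGamma ha) (hGamma hca)) (Finset.prod_pos fun x _ =>
    div_pos (Real.Gamma_pos_of_pos (hca x)) (Real.Gamma_pos_of_pos (ha x)))

lemma log_bayesMeasure [Nonempty α] (ha : ∀ x, 0 < a x) (c : α → ℕ) :
    Real.log (bayesMeasure a c) =
      Real.log (Real.Gamma (∑ x, a x)) - ∑ x, Real.log (Real.Gamma (a x)) +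
        (∑ x, Real.log (Real.Gamma (c x + a x)) -
          Real.log (Real.Gamma ((∑ x, c x : ℕ) + ∑ x, a x))) := by
  have hG {t : ℝ} (ht : 0 < t) : Real.Gamma t ≠ 0 := (Real.Gamma_pos_of_pos ht).ne'
  have hca (x : α) : 0 < (c x : ℝ) + a x := add_pos_of_nonneg_of_pos (Nat.cast_nonneg _) (ha x)
  have hs : 0 < ∑ x, a x := Finset.sum_pos (fun x _ => ha x) Finset.univ_nonempty
  have hN : 0 < ((∑ x, c x : ℕ) : ℝ) + ∑ x, a x :=
    add_pos_of_nonneg_of_pos (Nat.cast_nonneg _) hs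
  have hdiv (x : α) : Real.Gamma (c x + a x) / Real.Gamma (a x) ≠ 0 :=
    div_ne_zero (hG (hca x)) (hG (ha x))
  rw [bayesMeasure, sum_natCast_add, Real.log_mul (div_ne_zero (hG hs) (hG hN))
    (Finset.prod_ne_zero_iff.mpr fun x _ => hdiv x), Real.log_div (hG hs) (hG hN),
    Real.log_prod fun x _ => hdiv x]
  simp only [Real.log_div (hG (hca _)) (hG (ha _)), Finset.sum_sub_distrib]
  ring

/-- The terms of order `log N` in the expansion of the logarithm of the Bayes measure of a sequence
of length `N`. -/
noncomputable def logPenalty (a : α → ℝ) (c : α → ℕ) : ℝ :=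
  ∑ x, (a x - 1 / 2) * Real.log (c x) - (∑ x, a x - 1 / 2) * Real.log (∑ x, c x : ℕ)

lemma isBigO_log_bayesMeasure [Nonempty α] (ha : ∀ x, 0 < a x) :
    (fun c : α → ℕ => Real.log (bayesMeasure a c) -
      (Real.negMulLog (∑ x, c x : ℕ) - ∑ x, Real.negMulLog (c x) + logPenalty a c))
      =O[⊤] fun _ => (1 : ℝ) := by
  have hs : 0 < ∑ x, a x := Finset.sum_pos (fun x _ => ha x) Finset.univ_nonempty
  have hletter (x : α) : (fun c : α → ℕ => Real.log (Real.Gamma (c x + a x)) -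
      (c x * Real.log (c x) - c x + (a x - 1 / 2) * Real.log (c x))) =O[⊤] fun _ => (1 : ℝ) :=
    (isBigO_log_Gamma_nat_add (ha x)).comp_tendsto tendsto_top
  have hletters := IsBigO.fun_sum (s := Finset.univ) fun x _ => hletter x
  have htotal := (isBigO_log_Gamma_nat_add hs).comp_tendsto
    (tendsto_top : Tendsto (fun c : α → ℕ => ∑ x, c x) ⊤ ⊤)
  have hconst := isBigO_const_const
    (Real.log (Real.Gamma (∑ x, a x)) - ∑ x, Real.log (Real.Gamma (a x))) (one_ne_zero (α := ℝ))
    (⊤ : Filter (α → ℕ))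
  refine (hconst.add (hletters.sub htotal)).congr_left fun c => ?_
  simp only [Function.comp_apply, log_bayesMeasure ha, logPenalty, Real.negMulLog,
    Finset.sum_sub_distrib, Finset.sum_add_distrib, neg_mul, Finset.sum_neg_distrib, Nat.cast_sum]
  ring

lemma isBigO_logPenalty (a : α → ℝ) :
    logPenalty a =O[⊤] fun c : α → ℕ => Real.log (∑ x, c x : ℕ) := by
  refine (IsBigO.fun_sum fun x _ => .const_mul_left ?_ _).sub (isBigO_const_mul_self _ _ _)
  refine .of_norm_le fun c => ?_
  rw [Real.norm_of_nonneg (Real.log_natCast_nonneg _)]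
  rcases Nat.eq_zero_or_pos (c x) with h | h
  · rw [h, Nat.cast_zero, Real.log_zero]
    exact Real.log_natCast_nonneg _
  · exact Real.log_le_log (Nat.cast_pos.mpr h)
      (Nat.cast_le.mpr (Finset.single_le_sum_of_canonicallyOrdered (Finset.mem_univ x)))

variable {ι : Type*} {l : Filter ι} {c : ι → α → ℕ} {N : ι → ℕ} {p : α → ℝ}

lemma logPenalty_eq (c : α → ℕ) :
    logPenalty a c = ∑ x, (a x - 1 / 2) * (Real.log (c x) - Real.log (∑ x, c x : ℕ)) -
      ((Fintype.card α : ℝ) - 1) / 2 * Real.log (∑ x, c x : ℕ) := by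
  simp only [logPenalty, mul_sub, Finset.sum_sub_distrib, ← Finset.sum_mul, Finset.sum_const,
    Finset.card_univ, nsmul_eq_mul]
  ring

lemma isBigO_logPenalty_add (hcN : ∀ n, ∑ x, c n x = N n)
    (hp : ∀ x, Tendsto (fun n => (c n x : ℝ) / N n) l (nhds (p x)))
    (hprior : ∀ x, p x = 0 → a x = 1 / 2) :
    (fun n => logPenalty a (c n) + ((Fintype.card α : ℝ) - 1) / 2 * Real.log (N n))
      =O[l] fun _ => (1 : ℝ) := by
  simp only [logPenalty_eq, hcN, sub_add_cancel]
  refine IsBigO.fun_sum fun x _ => ?_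
  rcases eq_or_ne (p x) 0 with h | h
  · simp only [hprior x h, sub_self, zero_mul]
    exact isBigO_zero _ _
  · refine .const_mul_left ((((hp x).log h).isBigO_one ℝ).congr' ?_ .rfl) _
    filter_upwards [(hp x).eventually_ne h] with n hn
    obtain ⟨hc, hN⟩ := div_ne_zero_iff.mp hn
    exact Real.log_div hc hN

end BayesMeasure

section BayesFactor

open Asymptotics

variable {α β : Type*} [Fintype α] [Fintype β] {a : α → ℝ} {a' : β → ℝ} {b : α → β → ℝ}

/-- The logarithm of the Bayes factor of dependence against independence for the contingency
table `c`; its quotient by the sample size is the weight of the pair of variables. -/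
noncomputable def logBayesFactor (a : α → ℝ) (a' : β → ℝ) (b : α → β → ℝ) (c : α → β → ℕ) : ℝ :=
  Real.log (bayesMeasure (fun z : α × β => b z.1 z.2) (fun z => c z.1 z.2) /
    (bayesMeasure a (fun u => ∑ v, c u v) * bayesMeasure a' (fun v => ∑ u, c u v)))

/-- The terms of order `log N` in the expansion of the logarithm of the Bayes factor of a
contingency table with `N` observations. -/
noncomputable def tablePenalty (a : α → ℝ) (a' : β → ℝ) (b : α → β → ℝ) (c : α → β → ℕ) : ℝ :=
  logPenalty (fun z : α × β => b z.1 z.2) (fun z => c z.1 z.2) -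
    logPenalty a (fun u => ∑ v, c u v) - logPenalty a' (fun v => ∑ u, c u v)

lemma isBigO_logBayesFactor [Nonempty α] [Nonempty β] (ha : ∀ u, 0 < a u) (ha' : ∀ v, 0 < a' v)
    (hb : ∀ u v, 0 < b u v) :
    (fun c : α → β → ℕ => logBayesFactor a a' b c -
      (tableInfo (fun u v => (c u v : ℝ)) + tablePenalty a a' b c)) =O[⊤] fun _ => (1 : ℝ) := by
  have hrow := (isBigO_log_bayesMeasure ha).comp_tendsto
    (tendsto_top (f := fun (c : α → β → ℕ) u => ∑ v, c u v) (l := ⊤))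
  have hcol := (isBigO_log_bayesMeasure ha').comp_tendsto
    (tendsto_top (f := fun (c : α → β → ℕ) v => ∑ u, c u v) (l := ⊤))
  have hpair := (isBigO_log_bayesMeasure fun z : α × β => hb z.1 z.2).comp_tendsto
    (tendsto_top (f := fun (c : α → β → ℕ) z => c z.1 z.2) (l := ⊤))
  refine ((hpair.sub hrow).sub hcol).congr_left fun c => ?_
  have hposb := bayesMeasure_pos (fun z : α × β => hb z.1 z.2) fun z => c z.1 z.2
  have hpos := bayesMeasure_pos ha fun u => ∑ v, c u v
  have hpos' := bayesMeasure_pos ha' fun v => ∑ u, c u v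
  have hcomm : ∑ v, ∑ u, (c u v : ℝ) = ∑ u, ∑ v, (c u v : ℝ) := Finset.sum_comm
  rw [logBayesFactor, Real.log_div hposb.ne' (mul_pos hpos hpos').ne',
    Real.log_mul hpos.ne' hpos'.ne']
  simp only [Function.comp_apply, tableInfo, tablePenalty, Fintype.sum_prod_type, Nat.cast_sum,
    hcomm]
  ring

variable {ι : Type*} {l : Filter ι} {c : ι → α → β → ℕ} {N : ι → ℕ}

lemma isBigO_tablePenalty (hcN : ∀ n, ∑ u, ∑ v, c n u v = N n) :
    (fun n => tablePenalty a a' b (c n)) =O[l] fun n => Real.log (N n) := by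
  have hrow := (isBigO_logPenalty a).comp_tendsto
    (tendsto_top (f := fun n u => ∑ v, c n u v) (l := l))
  have hcol := (isBigO_logPenalty a').comp_tendsto
    (tendsto_top (f := fun n v => ∑ u, c n u v) (l := l))
  have hpair := (isBigO_logPenalty fun z : α × β => b z.1 z.2).comp_tendsto
    (tendsto_top (f := fun n z => c n z.1 z.2) (l := l))
  have hcN' (n : ι) : ∑ v, ∑ u, c n u v = N n := by rw [Finset.sum_comm, hcN]
  simp only [Function.comp_def, Fintype.sum_prod_type, hcN, hcN'] at hrow hcol hpair
  exact (hpair.sub hrow).sub hcol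

lemma tendsto_logBayesFactor_div [Nonempty α] [Nonempty β] {p : α → β → ℝ} (ha : ∀ u, 0 < a u)
    (ha' : ∀ v, 0 < a' v) (hb : ∀ u v, 0 < b u v) (hcN : ∀ n, ∑ u, ∑ v, c n u v = N n)
    (hN : Tendsto N l atTop)
    (hp : ∀ u v, Tendsto (fun n => (c n u v : ℝ) / N n) l (nhds (p u v))) :
    Tendsto (fun n => logBayesFactor a a' b (c n) / N n) l (nhds (tableInfo p)) := by
  have hNR : Tendsto (fun n => (N n : ℝ)) l atTop := tendsto_natCast_atTop_atTop.comp hN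
  have hinfo : Tendsto (fun n => tableInfo fun u v => (c n u v : ℝ) / N n) l
      (nhds (tableInfo p)) :=
    (continuous_tableInfo.tendsto p).comp
      (tendsto_pi_nhds.mpr fun u => tendsto_pi_nhds.mpr fun v => hp u v)
  have hone : (fun _ : ι => (1 : ℝ)) =o[l] fun n => (N n : ℝ) :=
    (isLittleO_const_id_atTop 1).comp_tendsto hNR
  have hbounded := ((isBigO_logBayesFactor ha ha' hb).comp_tendsto
    (tendsto_top (f := c) (l := l))).trans_isLittleO hone
  have hpenalty := (isBigO_tablePenalty (a := a) (a' := a') (b := b) (l := l) hcN).trans_isLittleO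
    (Real.isLittleO_log_id_atTop.comp_tendsto hNR)
  have h := (hinfo.add hpenalty.tendsto_div_nhds_zero).add hbounded.tendsto_div_nhds_zero
  rw [add_zero, add_zero] at h
  refine h.congr fun n => ?_
  simp only [div_eq_inv_mul, tableInfo_mul, Function.comp_apply, id]
  ring

variable {q : α → ℝ} {q' : β → ℝ}

lemma tendsto_div_of_isLittleO_sqrt {x : ι → ℝ} {p : ℝ} (hN : Tendsto N l atTop)
    (hx : (fun n => x n - N n * p) =o[l] fun n => √(N n * Real.log (N n))) :
    Tendsto (fun n => x n / N n) l (nhds p) := by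
  have hNR : Tendsto (fun n => (N n : ℝ)) l atTop := tendsto_natCast_atTop_atTop.comp hN
  have hsqrt : (fun n => √(N n * Real.log (N n))) =O[l] fun n => (N n : ℝ) := by
    refine .of_bound' ?_
    filter_upwards with n
    rw [Real.norm_of_nonneg (Real.sqrt_nonneg _), Real.norm_natCast]
    refine Real.sqrt_le_iff.mpr ⟨Nat.cast_nonneg _, ?_⟩
    rw [sq]
    gcongr
    exact Real.log_le_self (Nat.cast_nonneg _)
  have h := (hx.trans_isBigO hsqrt).tendsto_div_nhds_zero.add_const p
  rw [zero_add] at h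
  refine h.congr' ?_
  filter_upwards [hNR.eventually_gt_atTop 0] with n hn
  field_simp
  ring

lemma isBigO_tablePenalty_add (hcN : ∀ n, ∑ u, ∑ v, c n u v = N n)
    (hp : ∀ u v, Tendsto (fun n => (c n u v : ℝ) / N n) l (nhds (q u * q' v)))
    (hq1 : ∑ u, q u = 1) (hq1' : ∑ v, q' v = 1) (ha : ∀ u, q u = 0 → a u = 1 / 2)
    (ha' : ∀ v, q' v = 0 → a' v = 1 / 2) (hb : ∀ u v, q u * q' v = 0 → b u v = 1 / 2) :
    (fun n => tablePenalty a a' b (c n) +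
      ((Fintype.card α : ℝ) - 1) * ((Fintype.card β : ℝ) - 1) / 2 * Real.log (N n))
      =O[l] fun _ => (1 : ℝ) := by
  have hrow (u : α) : Tendsto (fun n => ((∑ v, c n u v : ℕ) : ℝ) / N n) l (nhds (q u)) := by
    simpa [Finset.sum_div, ← Finset.mul_sum, hq1'] using
      tendsto_finsetSum Finset.univ fun v _ => hp u v
  have hcol (v : β) : Tendsto (fun n => ((∑ u, c n u v : ℕ) : ℝ) / N n) l (nhds (q' v)) := by
    simpa [Finset.sum_div, ← Finset.sum_mul, hq1] using
      tendsto_finsetSum Finset.univ fun u _ => hp u v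
  have hpairO := isBigO_logPenalty_add (c := fun n (z : α × β) => c n z.1 z.2)
    (by simpa only [Fintype.sum_prod_type] using hcN) (fun z => hp z.1 z.2) fun z => hb z.1 z.2
  have hrowO := isBigO_logPenalty_add hcN hrow ha
  have hcolO := isBigO_logPenalty_add (fun n => by rw [Finset.sum_comm, hcN]) hcol ha'
  refine ((hpairO.sub hrowO).sub hcolO).congr_left fun n => ?_
  simp only [tablePenalty, Fintype.card_prod, Nat.cast_mul]
  ring

lemma exists_tableInfo_le_isLittleO_log (hcN : ∀ n, ∑ u, ∑ v, c n u v = N n)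
    (hN : Tendsto N l atTop)
    (hdev : ∀ u v, (fun n => (c n u v : ℝ) - N n * (q u * q' v)) =o[l]
      fun n => √(N n * Real.log (N n)))
    (hq : ∀ u, 0 ≤ q u) (hq' : ∀ v, 0 ≤ q' v) (hq1 : ∑ u, q u = 1) (hq1' : ∑ v, q' v = 1)
    (hsupp : ∀ n u v, q u * q' v = 0 → c n u v = 0) :
    ∃ r : ι → ℝ, r =o[l] (fun n => Real.log (N n)) ∧
      ∀ᶠ n in l, tableInfo (fun u v => (c n u v : ℝ)) ≤ r n := by
  refine ⟨fun n => ∑ u, ∑ v, ((c n u v : ℝ) - N n * (q u * q' v)) ^ 2 / (N n * (q u * q' v)),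
    IsLittleO.fun_sum fun u _ => IsLittleO.fun_sum fun v _ => ?_, ?_⟩
  · have hsq := ((hdev u v).pow two_pos).mul_isBigO
      (isBigO_refl (fun n => ((N n : ℝ) * (q u * q' v))⁻¹) l)
    have hscale : (fun n => √(N n * Real.log (N n)) ^ 2 * ((N n : ℝ) * (q u * q' v))⁻¹) =O[l]
        fun n => Real.log (N n) := by
      refine (isBigO_const_mul_self (q u * q' v)⁻¹ (fun n => Real.log (N n)) l).congr' ?_ .rfl
      filter_upwards [hN.eventually_gt_atTop 0] with n hn
      have hn : (0 : ℝ) < N n := Nat.cast_pos.mpr hn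
      rw [Real.sq_sqrt (mul_nonneg hn.le (Real.log_natCast_nonneg _))]
      field_simp
    simpa only [div_eq_mul_inv] using hsq.trans_isBigO hscale
  · filter_upwards [hN.eventually_gt_atTop 0] with n hn
    exact tableInfo_le_chiSq (fun u v => Nat.cast_nonneg _) (mod_cast hcN n)
      (Nat.cast_pos.mpr hn) hq hq' hq1 hq1' fun u v h => mod_cast hsupp n u v h

-- The information gain is `o(log N)`, but the penalty is of order `log N`, with coefficient half
-- the number of degrees of freedom of the table.
lemma eventually_logBayesFactor_nonpos [Nontrivial α] [Nontrivial β] (hpos : ∀ u, 0 < a u)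
    (hpos' : ∀ v, 0 < a' v) (hposb : ∀ u v, 0 < b u v) (hcN : ∀ n, ∑ u, ∑ v, c n u v = N n)
    (hN : Tendsto N l atTop)
    (hdev : ∀ u v, (fun n => (c n u v : ℝ) - N n * (q u * q' v)) =o[l]
      fun n => √(N n * Real.log (N n)))
    (hq : ∀ u, 0 ≤ q u) (hq' : ∀ v, 0 ≤ q' v) (hq1 : ∑ u, q u = 1) (hq1' : ∑ v, q' v = 1)
    (hsupp : ∀ n u v, q u * q' v = 0 → c n u v = 0) (ha : ∀ u, q u = 0 → a u = 1 / 2)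
    (ha' : ∀ v, q' v = 0 → a' v = 1 / 2) (hb : ∀ u v, q u * q' v = 0 → b u v = 1 / 2) :
    ∀ᶠ n in l, logBayesFactor a a' b (c n) ≤ 0 := by
  have hlog : Tendsto (fun n => Real.log (N n)) l atTop :=
    Real.tendsto_log_atTop.comp (tendsto_natCast_atTop_atTop.comp hN)
  obtain ⟨r, hr, hinfo⟩ := exists_tableInfo_le_isLittleO_log hcN hN hdev hq hq' hq1 hq1' hsupp
  have hpenalty := isBigO_tablePenalty_add hcN (fun u v => tendsto_div_of_isLittleO_sqrt hN
    (hdev u v)) hq1 hq1' ha ha' hb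
  have hbounded := (isBigO_logBayesFactor hpos hpos' hposb).comp_tendsto
    (tendsto_top (f := c) (l := l))
  have hone : (fun _ : ι => (1 : ℝ)) =o[l] fun n => Real.log (N n) :=
    (isLittleO_const_id_atTop 1).comp_tendsto hlog
  set d := ((Fintype.card α : ℝ) - 1) * ((Fintype.card β : ℝ) - 1) / 2
  have hd : 0 < d := by
    have hcard : (1 : ℝ) < Fintype.card α := mod_cast Fintype.one_lt_card
    have hcard' : (1 : ℝ) < Fintype.card β := mod_cast Fintype.one_lt_card
    exact half_pos (mul_pos (sub_pos.mpr hcard) (sub_pos.mpr hcard'))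
  have hrest := (hr.add ((hpenalty.add hbounded).trans_isLittleO hone)).bound hd
  filter_upwards [hinfo, hrest, hlog.eventually_ge_atTop 0] with n hinfo hrest hlog
  rw [Real.norm_of_nonneg hlog] at hrest
  have := (le_abs_self _).trans hrest
  simp only [Function.comp_apply] at this
  linarith

end BayesFactor

section Marginals

variable {V : Type*} {A : V → Type*} [∀ i, MeasurableSpace (A i)] (P : Measure (∀ i, A i))

lemma marginal_nonneg (i : V) (u : A i) : 0 ≤ marginal P i u := measureReal_nonneg

lemma pairMarginal_nonneg (i j : V) (u : A i) (v : A j) : 0 ≤ pairMarginal P i j u v :=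
  measureReal_nonneg

lemma pairMarginal_comm (i j : V) (u : A i) (v : A j) :
    pairMarginal P i j u v = pairMarginal P j i v u := by
  simp only [pairMarginal, and_comm]

section

variable [IsFiniteMeasure P]

lemma pairMarginal_le_left (i j : V) (u : A i) (v : A j) :
    pairMarginal P i j u v ≤ marginal P i u :=
  measureReal_mono fun _ h => h.1

lemma pairMarginal_eq_zero {i j : V} {u : A i} {v : A j}
    (h : marginal P i u * marginal P j v = 0) : pairMarginal P i j u v = 0 := by
  refine le_antisymm ?_ (pairMarginal_nonneg P i j u v)
  rcases mul_eq_zero.mp h with h | h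
  · exact h ▸ pairMarginal_le_left P i j u v
  · exact h ▸ pairMarginal_comm P i j u v ▸ pairMarginal_le_left P j i v u

lemma pairMarginal_pos {x : ∀ i, A i} (hx : P.real {x} ≠ 0) (i j : V) :
    0 < pairMarginal P i j (x i) (x j) :=
  (measureReal_nonneg.lt_of_ne' hx).trans_le <| measureReal_mono <|
    Set.singleton_subset_iff.mpr ⟨rfl, rfl⟩

lemma marginal_pos {x : ∀ i, A i} (hx : P.real {x} ≠ 0) (i : V) : 0 < marginal P i (x i) :=
  (pairMarginal_pos P hx i i).trans_le (pairMarginal_le_left P i i _ _)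

end

variable [∀ i, Fintype (A i)] [∀ i, MeasurableSingletonClass (A i)]

lemma sum_pairMarginal_right [IsFiniteMeasure P] (i j : V) (u : A i) :
    ∑ v, pairMarginal P i j u v = marginal P i u := by
  have hS : MeasurableSet {y : ∀ i, A i | y i = u} :=
    measurable_pi_apply i (measurableSet_singleton u)
  have h := sum_measureReal_preimage_singleton (μ := P.restrict {y | y i = u})
    (f := fun y : ∀ i, A i => y j) Finset.univ
    fun v _ => measurable_pi_apply j (measurableSet_singleton v)
  simp only [measureReal_restrict_apply' hS, Finset.coe_univ, Set.preimage_univ,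
    Set.univ_inter] at h
  rw [marginal, ← h]
  refine Finset.sum_congr rfl fun v _ => congrArg P.real ?_
  ext y
  exact and_comm

lemma sum_pairMarginal_left [IsFiniteMeasure P] (i j : V) (v : A j) :
    ∑ u, pairMarginal P i j u v = marginal P j v := by
  simp only [pairMarginal_comm P i j, sum_pairMarginal_right]

variable [IsProbabilityMeasure P]

lemma sum_marginal (i : V) : ∑ u, marginal P i u = 1 := by
  have h := sum_measureReal_preimage_singleton (μ := P) (f := fun y : ∀ i, A i => y i) Finset.univ
    fun u _ => measurable_pi_apply i (measurableSet_singleton u)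
  rwa [Finset.coe_univ, Set.preimage_univ, probReal_univ] at h

lemma sum_pairMarginal (i j : V) : ∑ u, ∑ v, pairMarginal P i j u v = 1 := by
  simp only [sum_pairMarginal_right, sum_marginal]

lemma mutualInfo_eq_tableInfo (i j : V) : mutualInfo P i j = tableInfo (pairMarginal P i j) := by
  rw [tableInfo_eq_relEntropy (pairMarginal_nonneg P i j) (sum_pairMarginal P i j), relEntropy,
    Fintype.sum_prod_type]
  simp only [sum_pairMarginal_right, sum_pairMarginal_left, mutualInfo]

lemma pairMarginal_eq_mul_of_mutualInfo_nonpos {i j : V} (h : mutualInfo P i j ≤ 0) (u : A i)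
    (v : A j) : pairMarginal P i j u v = marginal P i u * marginal P j v := by
  have heq := eq_of_relEntropy_nonpos (p := fun z : A i × A j => pairMarginal P i j z.1 z.2)
    (q := fun z => marginal P i z.1 * marginal P j z.2) (fun _ => pairMarginal_nonneg _ _ _ _ _)
    (fun _ => mul_nonneg (marginal_nonneg _ _ _) (marginal_nonneg _ _ _))
    (fun _ => pairMarginal_eq_zero P)
    (by simp only [Fintype.sum_prod_type, sum_pairMarginal, ← Finset.mul_sum, sum_marginal,
      mul_one, le_refl])
    (by simpa only [relEntropy, Fintype.sum_prod_type] using! h)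
  exact congrFun heq (u, v)

end Marginals

section ForestDensity

variable {V : Type*} {A : V → Type*} [∀ i, MeasurableSpace (A i)] (P : Measure (∀ i, A i))

lemma edgeFactor_mk (x : ∀ i, A i) (i j : V) : edgeFactor P x s(i, j) =
    pairMarginal P i j (x i) (x j) / (marginal P i (x i) * marginal P j (x j)) := rfl

lemma edgeFactor_nonneg (x : ∀ i, A i) (e : Sym2 V) : 0 ≤ edgeFactor P x e := by
  induction e with | h i j
  exact div_nonneg (pairMarginal_nonneg _ _ _ _ _)
    (mul_nonneg (marginal_nonneg _ _ _) (marginal_nonneg _ _ _))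

lemma edgeFactor_pos [IsFiniteMeasure P] {x : ∀ i, A i} (hx : P.real {x} ≠ 0) (e : Sym2 V) :
    0 < edgeFactor P x e := by
  induction e with | h i j
  exact div_pos (pairMarginal_pos P hx i j) (mul_pos (marginal_pos P hx i) (marginal_pos P hx j))

lemma edgeFactor_update [DecidableEq V] {e : Sym2 V} {v : V} (hv : v ∉ e) (x : ∀ i, A i)
    (u : A v) : edgeFactor P (Function.update x v u) e = edgeFactor P x e := by
  induction e with | h i j
  rw [Sym2.mem_iff, not_or] at hv
  simp only [edgeFactor_mk, Function.update_of_ne (Ne.symm hv.1),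
    Function.update_of_ne (Ne.symm hv.2)]

variable [Fintype V]

/-- The weight `∏_{i ∈ V} P(x_i) ∏_{{i,j} ∈ E} P(x_i, x_j) / (P(x_i) P(x_j))`, the candidate for
the law `P` if `P` factors along `E`. -/
noncomputable def forestDensity (E : Finset (Sym2 V)) (x : ∀ i, A i) : ℝ :=
  (∏ i, marginal P i (x i)) * ∏ e ∈ E, edgeFactor P x e

lemma factorsAlongForest_iff {E : Finset (Sym2 V)} :
    FactorsAlongForest P E ↔ IsForest E ∧ (fun x => P.real {x}) = forestDensity P E := by
  rw [funext_iff, FactorsAlongForest, IsForest, and_assoc]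
  rfl

lemma forestDensity_nonneg (E : Finset (Sym2 V)) (x : ∀ i, A i) : 0 ≤ forestDensity P E x :=
  mul_nonneg (Finset.prod_nonneg fun _ _ => marginal_nonneg _ _ _)
    (Finset.prod_nonneg fun _ _ => edgeFactor_nonneg _ _ _)

lemma forestDensity_pos [IsFiniteMeasure P] (E : Finset (Sym2 V)) {x : ∀ i, A i}
    (hx : P.real {x} ≠ 0) : 0 < forestDensity P E x :=
  mul_pos (Finset.prod_pos fun i _ => marginal_pos P hx i)
    (Finset.prod_pos fun e _ => edgeFactor_pos P hx e)

variable [DecidableEq V]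

lemma edgeFactor_mul_forestDensity_erase {E : Finset (Sym2 V)} {e : Sym2 V} (he : e ∈ E)
    (x : ∀ i, A i) : edgeFactor P x e * forestDensity P (E.erase e) x = forestDensity P E x := by
  rw [forestDensity, forestDensity, mul_left_comm, Finset.mul_prod_erase _ _ he]

lemma forestDensity_update {E : Finset (Sym2 V)} {v : V} (hv : ∀ e ∈ E, v ∉ e) (x : ∀ i, A i)
    (u : A v) : forestDensity P E (Function.update x v u) = marginal P v u *
      ((∏ i ∈ Finset.univ.erase v, marginal P i (x i)) * ∏ e ∈ E, edgeFactor P x e) := by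
  rw [forestDensity, ← Finset.mul_prod_erase _ _ (Finset.mem_univ v), Function.update_self,
    mul_assoc, Finset.prod_congr rfl fun e he => edgeFactor_update P (hv e he) x u]
  congr 2
  exact Finset.prod_congr rfl fun i hi => by rw [Function.update_of_ne (Finset.ne_of_mem_erase hi)]

end ForestDensity

section TotalMass

variable {V : Type*} [DecidableEq V] {A : V → Type*} [∀ i, Fintype (A i)]

lemma sum_sum_update [Fintype V] (v : V) (f : (∀ i, A i) → ℝ) :
    ∑ x, ∑ u, f (Function.update x v u) = Fintype.card (A v) * ∑ x, f x := by
  have hinv : Function.Involutive fun z : (∀ i, A i) × A v =>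
      (Function.update z.1 v z.2, z.1 v) := fun z => by
    simp only [Function.update_idem, Function.update_eq_self, Function.update_self]
  calc ∑ x, ∑ u, f (Function.update x v u)
      = ∑ z : (∀ i, A i) × A v, f (hinv.toPerm _ z).1 := (Fintype.sum_prod_type' _).symm
    _ = ∑ z : (∀ i, A i) × A v, f z.1 := Equiv.sum_comp (hinv.toPerm _) fun z => f z.1
    _ = Fintype.card (A v) * ∑ x, f x := by
      simp only [Fintype.sum_prod_type, Finset.sum_const, Finset.card_univ, nsmul_eq_mul,
        Finset.mul_sum]

lemma sum_le_sum_of_sum_update_le [Fintype V] (v : V) {f g : (∀ i, A i) → ℝ}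
    (h : ∀ x, ∑ u, f (Function.update x v u) ≤ ∑ u, g (Function.update x v u)) :
    ∑ x, f x ≤ ∑ x, g x := by
  rcases isEmpty_or_nonempty (∀ i, A i) with hA | ⟨⟨x⟩⟩
  · simp only [Finset.univ_eq_empty, Finset.sum_empty, le_refl]
  have hcard : (0 : ℝ) < Fintype.card (A v) := Nat.cast_pos.mpr (Fintype.card_pos_iff.mpr ⟨x v⟩)
  have hsum := Finset.sum_le_sum fun x (_ : x ∈ Finset.univ) => h x
  rw [sum_sum_update, sum_sum_update] at hsum
  exact le_of_mul_le_mul_left hsum hcard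

variable [∀ i, MeasurableSpace (A i)] [∀ i, MeasurableSingletonClass (A i)]
  (P : Measure (∀ i, A i))

lemma sum_edgeFactor_mul_marginal_le [IsFiniteMeasure P] {v w : V} (hvw : v ≠ w) (x : ∀ i, A i) :
    ∑ u, edgeFactor P (Function.update x v u) s(v, w) * marginal P v u ≤ 1 := by
  have hterm (u : A v) : edgeFactor P (Function.update x v u) s(v, w) * marginal P v u ≤
      pairMarginal P v w u (x w) / marginal P w (x w) := by
    rw [edgeFactor_mk, Function.update_self, Function.update_of_ne hvw.symm]
    rcases (marginal_nonneg P v u).eq_or_lt with h | h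
    · rw [← h, mul_zero]
      exact div_nonneg (pairMarginal_nonneg _ _ _ _ _) (marginal_nonneg _ _ _)
    · rw [div_mul_eq_mul_div, mul_comm, mul_div_mul_left _ _ h.ne']
  calc ∑ u, edgeFactor P (Function.update x v u) s(v, w) * marginal P v u
      ≤ ∑ u, pairMarginal P v w u (x w) / marginal P w (x w) :=
        Finset.sum_le_sum fun u _ => hterm u
    _ = marginal P w (x w) / marginal P w (x w) := by
        rw [← Finset.sum_div, sum_pairMarginal_left]
    _ ≤ 1 := div_self_le_one _

variable [Fintype V] [IsProbabilityMeasure P] {E : Finset (Sym2 V)}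

lemma sum_forestDensity_le_erase_of_leaf {v w : V} (hvw : v ≠ w) (he : s(v, w) ∈ E)
    (hleaf : ∀ e ∈ E.erase s(v, w), v ∉ e) :
    ∑ x, forestDensity P E x ≤ ∑ x, forestDensity P (E.erase s(v, w)) x := by
  refine sum_le_sum_of_sum_update_le v fun x => ?_
  simp only [← edgeFactor_mul_forestDensity_erase P he, forestDensity_update P hleaf, ← mul_assoc,
    ← Finset.sum_mul, sum_marginal]
  gcongr
  · exact Finset.prod_nonneg fun _ _ => edgeFactor_nonneg _ _ _
  · exact Finset.prod_nonneg fun _ _ => marginal_nonneg _ _ _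
  · exact sum_edgeFactor_mul_marginal_le P hvw x

lemma sum_forestDensity_empty : ∑ x, forestDensity P ∅ x = 1 := by
  simp only [forestDensity, Finset.prod_empty, mul_one]
  rw [← Fintype.piFinset_univ, ← Finset.prod_univ_sum]
  simp only [sum_marginal, Finset.prod_const_one]

-- Not an equality: `P(x_i, x_j) / P(x_j)` is not a probability vector if `P(x_j) = 0`.
lemma IsForest.sum_forestDensity_le_one (hE : IsForest E) : ∑ x, forestDensity P E x ≤ 1 := by
  induction E using Finset.strongInduction with | H E ih
  rcases E.eq_empty_or_nonempty with rfl | hne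
  · exact (sum_forestDensity_empty P).le
  · obtain ⟨v, w, hvw, he, hleaf⟩ := hE.exists_leaf_edge hne
    exact (sum_forestDensity_le_erase_of_leaf P hvw he hleaf).trans
      (ih _ (Finset.erase_ssubset he) (hE.mono (Finset.erase_subset _ _)))

end TotalMass

section TrueForest

lemma sum_real_fiber_mul {Ω α : Type*} [Fintype Ω] [Fintype α] [MeasurableSpace Ω]
    [MeasurableSingletonClass Ω] (P : Measure Ω) [IsFiniteMeasure P] (f : Ω → α) (g : α → ℝ) :
    ∑ t, P.real {x | f x = t} * g t = ∑ x, P.real {x} * g (f x) := by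
  classical
  rw [← Finset.sum_fiberwise (s := Finset.univ) (g := f)]
  refine Finset.sum_congr rfl fun t _ => ?_
  have hfiber : P.real {x | f x = t} = ∑ x with f x = t, P.real {x} := by
    rw [sum_measureReal_singleton, Finset.coe_filter_univ]
  rw [hfiber, Finset.sum_mul]
  refine Finset.sum_congr rfl fun x hx => ?_
  rw [(Finset.mem_filter.mp hx).2]

variable {V : Type*} {A : V → Type*} [∀ i, MeasurableSpace (A i)] [∀ i, Fintype (A i)]
  (P : Measure (∀ i, A i))

lemma mutualInfo_comm (i j : V) : mutualInfo P i j = mutualInfo P j i := by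
  rw [mutualInfo, mutualInfo, Finset.sum_comm]
  simp only [pairMarginal_comm P i j, mul_comm (marginal P i _)]

/-- The mutual information as a function of the unordered pair. -/
noncomputable def edgeInfo : Sym2 V → ℝ :=
  Sym2.lift ⟨mutualInfo P, mutualInfo_comm P⟩

variable [Fintype V] [DecidableEq V] [∀ i, MeasurableSingletonClass (A i)]

lemma sum_real_singleton [IsProbabilityMeasure P] : ∑ x : ∀ i, A i, P.real {x} = 1 := by
  rw [sum_measureReal_singleton, Finset.coe_univ, probReal_univ]

lemma sum_pairMarginal_mul [IsFiniteMeasure P] (i j : V) (g : A i → A j → ℝ) :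
    ∑ u, ∑ v, pairMarginal P i j u v * g u v =
      ∑ x : ∀ i, A i, P.real {x} * g (x i) (x j) := by
  rw [← Fintype.sum_prod_type', ← sum_real_fiber_mul P (fun x => (x i, x j)) fun z => g z.1 z.2]
  simp only [pairMarginal, Prod.ext_iff]

lemma edgeInfo_eq_sum [IsFiniteMeasure P] (e : Sym2 V) :
    edgeInfo P e = ∑ x : ∀ i, A i, P.real {x} * Real.log (edgeFactor P x e) := by
  induction e with | h i j
  exact sum_pairMarginal_mul P i j fun u v =>
    Real.log (pairMarginal P i j u v / (marginal P i u * marginal P j v))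

lemma relEntropy_forestDensity [IsFiniteMeasure P] (E : Finset (Sym2 V)) :
    relEntropy (fun x => P.real {x}) (forestDensity P E) =
      relEntropy (fun x => P.real {x}) (forestDensity P ∅) - ∑ e ∈ E, edgeInfo P e := by
  simp only [edgeInfo_eq_sum, relEntropy]
  rw [Finset.sum_comm, ← Finset.sum_sub_distrib]
  refine Finset.sum_congr rfl fun x _ => ?_
  rw [← Finset.mul_sum, ← mul_sub]
  rcases eq_or_ne (P.real {x}) 0 with h | h
  · rw [h, zero_mul, zero_mul]
  have hfactor (e : Sym2 V) : edgeFactor P x e ≠ 0 := (edgeFactor_pos P h e).ne'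
  have hmul : forestDensity P E x = forestDensity P ∅ x * ∏ e ∈ E, edgeFactor P x e := by
    rw [forestDensity, forestDensity, Finset.prod_empty, mul_one]
  rw [Real.log_div h (forestDensity_pos P E h).ne', Real.log_div h (forestDensity_pos P ∅ h).ne',
    hmul, Real.log_mul (forestDensity_pos P ∅ h).ne' (Finset.prod_ne_zero_iff.mpr fun e _ =>
    hfactor e), Real.log_prod fun e _ => hfactor e, sub_sub]

variable [IsProbabilityMeasure P] {E T : Finset (Sym2 V)}

lemma sum_edgeInfo_of_factorsAlongForest (hT : FactorsAlongForest P T) :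
    ∑ e ∈ T, edgeInfo P e = relEntropy (fun x => P.real {x}) (forestDensity P ∅) := by
  have h := relEntropy_forestDensity P T
  rw [← ((factorsAlongForest_iff P).mp hT).2, relEntropy_self] at h
  exact (sub_eq_zero.mp h.symm).symm

lemma factorsAlongForest_of_isChowLiuOutput (hT : FactorsAlongForest P T)
    (hE : IsChowLiuOutput (mutualInfo P) E) : FactorsAlongForest P E := by
  have hEF : IsForest E := ChowLiuState.isForest hE
  refine (factorsAlongForest_iff P).mpr ⟨hEF, eq_of_relEntropy_nonpos
    (fun _ => measureReal_nonneg) (forestDensity_nonneg P E) (fun x hx => ?_) ?_ ?_⟩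
  · by_contra h
    exact (forestDensity_pos P E h).ne' hx
  · rw [sum_real_singleton]
    exact hEF.sum_forestDensity_le_one P
  · rw [relEntropy_forestDensity, ← sum_edgeInfo_of_factorsAlongForest P hT, sub_nonpos]
    exact hE.sum_le (W := edgeInfo P) (fun _ _ => rfl) ((factorsAlongForest_iff P).mp hT).1

lemma isTrueForest_of_isChowLiuOutput (hT : FactorsAlongForest P T)
    (hE : IsChowLiuOutput (mutualInfo P) E) : IsTrueForest P E := by
  have hEP := factorsAlongForest_of_isChowLiuOutput P hT hE
  refine ⟨hEP, fun F hF hFE => ?_⟩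
  by_contra hne
  obtain ⟨e, heE, heF⟩ := Finset.not_subset.mp hne
  have hpos := ChowLiuState.weight_pos (W := edgeInfo P) (fun _ _ => rfl) hE
  have hlt := Finset.sum_lt_sum_of_subset hFE heE heF (hpos e heE) fun f hf _ => (hpos f hf).le
  rw [sum_edgeInfo_of_factorsAlongForest P hF, sum_edgeInfo_of_factorsAlongForest P hEP] at hlt
  exact hlt.false

end TrueForest

section MaximalInequality

open scoped NNReal

variable {Ω : Type*} [MeasurableSpace Ω] {μ : Measure Ω} {Y : ℕ → Ω → ℝ} {c : ℝ≥0}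

lemma integrable_exp_mul_sum (hindep : iIndepFun Y μ) (hsub : ∀ k, HasSubgaussianMGF (Y k) c μ)
    (t : ℝ) (n : ℕ) : Integrable (fun ω => Real.exp (t * ∑ k ∈ Finset.range n, Y k ω)) μ :=
  (HasSubgaussianMGF.sum_of_iIndepFun hindep fun k _ => hsub k).integrable_exp_mul t

lemma integral_exp_mul_sum_le (hindep : iIndepFun Y μ) (hsub : ∀ k, HasSubgaussianMGF (Y k) c μ)
    (t : ℝ) (n : ℕ) :
    ∫ ω, Real.exp (t * ∑ k ∈ Finset.range n, Y k ω) ∂μ ≤ Real.exp (n * c * t ^ 2 / 2) := by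
  simpa only [mgf, Finset.sum_const, Finset.card_range, nsmul_eq_mul, NNReal.coe_mul,
    NNReal.coe_natCast] using (HasSubgaussianMGF.sum_of_iIndepFun (s := Finset.range n) hindep
      fun k _ => hsub k).mgf_le t

variable [IsProbabilityMeasure μ]

lemma one_le_integral_exp_mul {Z : Ω → ℝ} (hsub : HasSubgaussianMGF Z c μ)
    (hmean : ∫ ω, Z ω ∂μ = 0) (t : ℝ) : 1 ≤ ∫ ω, Real.exp (t * Z ω) ∂μ := by
  have hinteg : Integrable (fun ω => t * Z ω) μ := hsub.integrable.const_mul t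
  calc (1 : ℝ) = ∫ ω, (t * Z ω + 1) ∂μ := by
        rw [integral_add hinteg (integrable_const 1), integral_const_mul, hmean, mul_zero, zero_add,
          integral_const, probReal_univ, one_smul]
    _ ≤ ∫ ω, Real.exp (t * Z ω) ∂μ := integral_mono (hinteg.add (integrable_const 1))
        (hsub.integrable_exp_mul t) fun ω => Real.add_one_le_exp _

lemma condExp_exp_mul_natural (hmeas : ∀ k, StronglyMeasurable (Y k)) (hindep : iIndepFun Y μ)
    (t : ℝ) (n : ℕ) :
    μ[fun ω => Real.exp (t * Y (n + 1) ω) | Filtration.natural Y hmeas n] =ᵐ[μ]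
      fun _ => ∫ ω, Real.exp (t * Y (n + 1) ω) ∂μ := by
  refine condExp_indep_eq (m₁ := MeasurableSpace.comap (Y (n + 1)) inferInstance)
    (hmeas (n + 1)).measurable.comap_le (Filtration.le _ _) ?_
    (hindep.indep_comap_natural_of_lt hmeas n.lt_succ_self)
  exact Real.continuous_exp.comp_stronglyMeasurable
    ((comap_measurable (Y (n + 1))).stronglyMeasurable.const_mul t)

lemma submartingale_exp_mul_sum (hmeas : ∀ k, StronglyMeasurable (Y k)) (hindep : iIndepFun Y μ)
    (hsub : ∀ k, HasSubgaussianMGF (Y k) c μ) (hmean : ∀ k, ∫ ω, Y k ω ∂μ = 0) (t : ℝ) :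
    Submartingale (fun n ω => Real.exp (t * ∑ k ∈ Finset.range (n + 1), Y k ω))
      (Filtration.natural Y hmeas) μ := by
  have hadapted (n : ℕ) : StronglyMeasurable[Filtration.natural Y hmeas n]
      fun ω => Real.exp (t * ∑ k ∈ Finset.range (n + 1), Y k ω) := by
    refine Real.continuous_exp.comp_stronglyMeasurable
      (StronglyMeasurable.const_mul (Finset.stronglyMeasurable_fun_sum _ fun k hk => ?_) t)
    exact (Filtration.stronglyAdapted_natural hmeas k).mono
      ((Filtration.natural Y hmeas).mono (Nat.lt_succ_iff.mp (Finset.mem_range.mp hk)))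
  refine submartingale_nat hadapted (fun n => integrable_exp_mul_sum hindep hsub t (n + 1))
    fun n => ?_
  have hsucc : (fun ω => Real.exp (t * ∑ k ∈ Finset.range (n + 1 + 1), Y k ω)) =
      (fun ω => Real.exp (t * ∑ k ∈ Finset.range (n + 1), Y k ω)) *
        fun ω => Real.exp (t * Y (n + 1) ω) := by
    funext ω
    rw [Pi.mul_apply, ← Real.exp_add, Finset.sum_range_succ _ (n + 1), mul_add]
  have hpull := condExp_mul_of_stronglyMeasurable_left (hadapted n)
    (hsucc ▸ integrable_exp_mul_sum hindep hsub t (n + 2)) ((hsub (n + 1)).integrable_exp_mul t)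
  rw [hsucc]
  filter_upwards [hpull, condExp_exp_mul_natural hmeas hindep t n] with ω hpull hcond
  rw [hpull, Pi.mul_apply, hcond]
  exact le_mul_of_one_le_right (Real.exp_pos _).le
    (one_le_integral_exp_mul (hsub (n + 1)) (hmean (n + 1)) t)

lemma measure_exists_le_sum_le (hmeas : ∀ k, StronglyMeasurable (Y k)) (hindep : iIndepFun Y μ)
    (hsub : ∀ k, HasSubgaussianMGF (Y k) c μ) (hmean : ∀ k, ∫ ω, Y k ω ∂μ = 0) (n : ℕ) {t : ℝ}
    (ht : 0 ≤ t) (x : ℝ) :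
    μ {ω | ∃ k < n, x ≤ ∑ i ∈ Finset.range (k + 1), Y i ω} ≤
      ENNReal.ofReal (Real.exp (n * c * t ^ 2 / 2 - t * x)) := by
  rcases n with - | n
  · simp only [not_lt_zero, false_and, exists_false, Set.ofPred_false, measure_empty, zero_le]
  set f : ℕ → Ω → ℝ := fun k ω => Real.exp (t * ∑ i ∈ Finset.range (k + 1), Y i ω)
  set U : Set Ω := {ω | Real.exp (t * x) ≤
    (Finset.range (n + 1)).sup' Finset.nonempty_range_add_one fun k => f k ω}
  have hsubset : {ω | ∃ k < n + 1, x ≤ ∑ i ∈ Finset.range (k + 1), Y i ω} ⊆ U := by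
    rintro ω ⟨k, hkn, hk⟩
    exact (Real.exp_le_exp.mpr (mul_le_mul_of_nonneg_left hk ht)).trans
      (Finset.le_sup' (fun k => f k ω) (Finset.mem_range.mpr hkn))
  have hdoob : ENNReal.ofReal (Real.exp (t * x)) * μ U ≤ ENNReal.ofReal (∫ ω in U, f n ω ∂μ) := by
    simpa only [Real.coe_toNNReal _ (Real.exp_pos (t * x)).le] using!
      maximal_ineq (submartingale_exp_mul_sum hmeas hindep hsub hmean t)
        (fun n ω => (Real.exp_pos _).le) (ε := (Real.exp (t * x)).toNNReal) n
  have hinteg : ∫ ω in U, f n ω ∂μ ≤ Real.exp ((n + 1 : ℕ) * c * t ^ 2 / 2) :=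
    (setIntegral_le_integral (integrable_exp_mul_sum hindep hsub t (n + 1))
      (.of_forall fun ω => (Real.exp_pos _).le)).trans
      (integral_exp_mul_sum_le hindep hsub t (n + 1))
  rw [Real.exp_sub, ENNReal.ofReal_div_of_pos (Real.exp_pos _), ENNReal.le_div_iff_mul_le
    (.inl (ENNReal.ofReal_pos.mpr (Real.exp_pos _)).ne') (.inl ENNReal.ofReal_ne_top), mul_comm]
  calc ENNReal.ofReal (Real.exp (t * x)) * μ _
      ≤ ENNReal.ofReal (Real.exp (t * x)) * μ U := by gcongr
    _ ≤ _ := hdoob.trans (ENNReal.ofReal_le_ofReal hinteg)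

end MaximalInequality

section IteratedLogarithm

open scoped NNReal

open Asymptotics

lemma monotone_sqrt_mul_log : Monotone fun n : ℕ => √(n * Real.log n) := by
  intro m n hmn
  refine Real.sqrt_le_sqrt ?_
  rcases m.eq_zero_or_pos with rfl | hm
  · simpa only [Nat.cast_zero, zero_mul] using
      mul_nonneg (Nat.cast_nonneg n) (Real.log_natCast_nonneg n)
  · gcongr

lemma eventually_lt_of_dyadic {S g : ℕ → ℝ} (hg : Monotone g)
    (h : ∀ᶠ r : ℕ in atTop, ∀ k < 2 ^ (r + 1), S (k + 1) < g (2 ^ r)) :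
    ∀ᶠ n in atTop, S n < g n := by
  obtain ⟨R, hR⟩ := eventually_atTop.mp h
  filter_upwards [eventually_ge_atTop (2 ^ R)] with n hn
  have hn0 : n ≠ 0 := (Nat.two_pow_pos R).trans_le hn |>.ne'
  have hlt : n < 2 ^ (Nat.log 2 n + 1) := Nat.lt_pow_succ_log_self one_lt_two n
  have hblock := hR _ (Nat.le_log_of_pow_le one_lt_two hn) (n - 1) ((Nat.sub_le n 1).trans_lt hlt)
  rw [Nat.sub_add_cancel (Nat.one_le_iff_ne_zero.mpr hn0)] at hblock
  exact hblock.trans_le (hg (Nat.pow_log_le_self 2 hn0))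

variable {Ω : Type*} [MeasurableSpace Ω] {μ : Measure Ω} [IsProbabilityMeasure μ]
  {Y : ℕ → Ω → ℝ} {c : ℝ≥0}

lemma measure_exists_mul_sqrt_le_sum_le (hmeas : ∀ k, StronglyMeasurable (Y k))
    (hindep : iIndepFun Y μ) (hsub : ∀ k, HasSubgaussianMGF (Y k) c μ)
    (hmean : ∀ k, ∫ ω, Y k ω ∂μ = 0) {δ : ℝ} (hδ : 0 ≤ δ) (ε : ℝ) (r : ℕ) :
    μ {ω | ∃ k < 2 ^ (r + 1),
        ε * √((2 ^ r : ℕ) * Real.log (2 ^ r : ℕ)) ≤ ∑ i ∈ Finset.range (k + 1), Y i ω} ≤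
      ENNReal.ofReal (Real.exp (δ * (c * δ - ε) * Real.log 2) ^ r) := by
  set L : ℝ := Real.log (2 ^ r : ℕ)
  have hL : 0 ≤ L := Real.log_natCast_nonneg _
  have hpow : (0 : ℝ) < (2 ^ r : ℕ) := Nat.cast_pos.mpr (Nat.two_pow_pos r)
  refine (measure_exists_le_sum_le hmeas hindep hsub hmean _
    (mul_nonneg hδ (Real.sqrt_nonneg (L / (2 ^ r : ℕ)))) _).trans_eq ?_
  have hsqrt : √(L / (2 ^ r : ℕ)) * √((2 ^ r : ℕ) * L) = L := by
    rw [← Real.sqrt_mul (div_nonneg hL hpow.le), div_mul_comm, mul_div_cancel_left₀ _ hpow.ne',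
      Real.sqrt_mul_self hL]
  rw [← Real.exp_nat_mul]
  congr 2
  calc ((2 ^ (r + 1) : ℕ) : ℝ) * c * (δ * √(L / (2 ^ r : ℕ))) ^ 2 / 2 -
        δ * √(L / (2 ^ r : ℕ)) * (ε * √((2 ^ r : ℕ) * L))
      = c * δ ^ 2 * ((2 ^ r : ℕ) * √(L / (2 ^ r : ℕ)) ^ 2) -
          δ * ε * (√(L / (2 ^ r : ℕ)) * √((2 ^ r : ℕ) * L)) := by
        rw [pow_succ 2 r, Nat.cast_mul]
        ring
    _ = δ * (c * δ - ε) * L := by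
        rw [hsqrt, Real.sq_sqrt (div_nonneg hL hpow.le), mul_div_cancel₀ _ hpow.ne']
        ring
    _ = r * (δ * (c * δ - ε) * Real.log 2) := by
        rw [show L = r * Real.log 2 by rw [← Real.log_pow]; norm_cast]
        ring

lemma ae_eventually_sum_lt (hmeas : ∀ k, StronglyMeasurable (Y k)) (hindep : iIndepFun Y μ)
    (hsub : ∀ k, HasSubgaussianMGF (Y k) c μ) (hmean : ∀ k, ∫ ω, Y k ω ∂μ = 0) {ε : ℝ}
    (hε : 0 < ε) :
    ∀ᵐ ω ∂μ, ∀ᶠ n : ℕ in atTop, ∑ k ∈ Finset.range n, Y k ω < ε * √(n * Real.log n) := by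
  obtain ⟨δ, hδ, hδε⟩ : ∃ δ > 0, c * δ < ε :=
    ⟨ε / (c + 1), by positivity, by
      rw [mul_div_assoc', div_lt_iff₀ (by positivity)]
      linarith [mul_comm (c : ℝ) ε]⟩
  have hρ : Real.exp (δ * (c * δ - ε) * Real.log 2) < 1 := Real.exp_lt_one_iff.mpr <|
    mul_neg_of_neg_of_pos (mul_neg_of_pos_of_neg hδ (sub_neg.mpr hδε)) (Real.log_pos one_lt_two)
  have hsummable : ∑' r : ℕ, μ {ω | ∃ k < 2 ^ (r + 1),
      ε * √((2 ^ r : ℕ) * Real.log (2 ^ r : ℕ)) ≤ ∑ i ∈ Finset.range (k + 1), Y i ω} ≠ ⊤ := by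
    refine ne_top_of_le_ne_top ?_ (ENNReal.tsum_le_tsum
      (measure_exists_mul_sqrt_le_sum_le hmeas hindep hsub hmean hδ.le ε))
    rw [← ENNReal.ofReal_tsum_of_nonneg (fun r => pow_nonneg (Real.exp_pos _).le r)
      (summable_geometric_of_lt_one (Real.exp_pos _).le hρ)]
    exact ENNReal.ofReal_ne_top
  filter_upwards [ae_eventually_notMem hsummable] with ω hω
  refine eventually_lt_of_dyadic (monotone_sqrt_mul_log.const_mul hε.le) ?_
  filter_upwards [hω] with r hr
  simpa only [Set.mem_ofPred_eq, not_exists, not_and, not_le] using hr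

/- A weak form of the law of the iterated logarithm: `log n` in place of `log log n`, which is
what the union bound over dyadic blocks gives without further work. -/
lemma ae_isLittleO_sum_sqrt_mul_log (hmeas : ∀ k, StronglyMeasurable (Y k))
    (hindep : iIndepFun Y μ) (hsub : ∀ k, HasSubgaussianMGF (Y k) c μ)
    (hmean : ∀ k, ∫ ω, Y k ω ∂μ = 0) :
    ∀ᵐ ω ∂μ, (fun n : ℕ => ∑ k ∈ Finset.range n, Y k ω) =o[atTop]
      fun n : ℕ => √(n * Real.log n) := by
  have hupper (q : ℕ) := ae_eventually_sum_lt hmeas hindep hsub hmean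
    (Nat.one_div_pos_of_nat (n := q))
  have hlower (q : ℕ) := ae_eventually_sum_lt (Y := fun k ω => -Y k ω) (fun k => (hmeas k).neg)
    (hindep.comp (fun _ y => -y) fun _ => measurable_neg) (fun k => (hsub k).neg)
    (fun k => by rw [integral_neg, hmean, neg_zero]) (Nat.one_div_pos_of_nat (n := q))
  filter_upwards [ae_all_iff.mpr hupper, ae_all_iff.mpr hlower] with ω hupper hlower
  refine isLittleO_iff.mpr fun ε hε => ?_
  obtain ⟨q, hq⟩ := exists_nat_one_div_lt hε
  filter_upwards [hupper q, hlower q] with n hupper hlower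
  rw [Finset.sum_neg_distrib] at hlower
  rw [Real.norm_eq_abs, Real.norm_of_nonneg (Real.sqrt_nonneg _)]
  exact (abs_le.mpr ⟨neg_le.mp hlower.le, hupper.le⟩).trans
    (mul_le_mul_of_nonneg_right hq.le (Real.sqrt_nonneg _))

end IteratedLogarithm

section Sampling

open Asymptotics

lemma sum_range_count_nth (s : ℕ → Prop) [DecidablePred s] (f : ℕ → ℝ) (n : ℕ) :
    ∑ j ∈ Finset.range (Nat.count s n), f (Nat.nth s j) = ∑ k ∈ Finset.range n with s k, f k := by
  induction n with
  | zero => rfl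
  | succ n ih =>
    rw [Finset.range_add_one, Finset.filter_insert, Nat.count_succ]
    by_cases hn : s n
    · rw [if_pos hn, if_pos hn, Finset.sum_insert (by simp), Finset.sum_range_succ, ih,
        Nat.nth_count hn, add_comm]
    · rw [if_neg hn, if_neg hn, add_zero, ih]

lemma infinite_of_tendsto_count {s : ℕ → Prop} [DecidablePred s]
    (hs : Tendsto (Nat.count s) atTop atTop) : (Set.ofPred s).Infinite := by
  intro hfin
  obtain ⟨n, hn⟩ := (hs.eventually_gt_atTop hfin.toFinset.card).exists
  refine hn.not_ge ?_
  rw [Nat.count_eq_card_filter_range]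
  exact Finset.card_le_card fun k hk => hfin.mem_toFinset.mpr (Finset.mem_filter.mp hk).2

variable {Ω : Type*} [MeasurableSpace Ω] {μ : Measure Ω}

lemma ae_of_forall_ae_of_indepFun [IsFiniteMeasure μ] {S T : Type*} [MeasurableSpace S]
    [MeasurableSpace T] {X : Ω → S} {M : Ω → T} (hX : AEMeasurable X μ) (hM : AEMeasurable M μ)
    (hXM : IndepFun X M μ) {E : Set (T × S)} (hE : MeasurableSet E)
    (h : ∀ m, ∀ᵐ ω ∂μ, (m, X ω) ∈ E) : ∀ᵐ ω ∂μ, (M ω, X ω) ∈ E := by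
  have hprod : ∀ᵐ z ∂(μ.map fun ω => (M ω, X ω)), z ∈ E := by
    rw [hXM.symm.map_prod_eq_prod_map_map hM hX]
    exact (Measure.ae_prod_iff_ae_ae (p := fun z => z ∈ E) hE).mpr
      (.of_forall fun m => (ae_map_iff hX (measurable_prodMk_left hE)).mpr (h m))
  exact ae_of_ae_map (hM.prodMk hX) hprod

variable [IsProbabilityMeasure μ] {S : Type*} [MeasurableSpace S] {P : Measure S} {X : ℕ → Ω → S}

section

variable {s : ℕ → Prop} [DecidablePred s]

lemma ae_isLittleO_sum_filter_sub (hX : ∀ k, Measurable (X k)) (hlaw : ∀ k, μ.map (X k) = P)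
    (hindep : iIndepFun X μ) {φ : S → ℝ} (hφ : Measurable φ) {a b : ℝ}
    (hmem : ∀ y, φ y ∈ Set.Icc a b) (hs : Tendsto (Nat.count s) atTop atTop) :
    ∀ᵐ ω ∂μ, (fun n => ∑ k ∈ Finset.range n with s k, (φ (X k ω) - ∫ y, φ y ∂P)) =o[atTop]
      fun n => √(Nat.count s n * Real.log (Nat.count s n)) := by
  have hφX (k : ℕ) : Measurable fun ω => φ (X k ω) := hφ.comp (hX k)
  have hmean (k : ℕ) : ∫ ω, φ (X k ω) ∂μ = ∫ y, φ y ∂P := by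
    rw [← hlaw k, integral_map (hX k).aemeasurable hφ.aestronglyMeasurable]
  have hsub (k : ℕ) :
      HasSubgaussianMGF (fun ω => φ (X k ω) - ∫ y, φ y ∂P) ((‖b - a‖₊ / 2) ^ 2) μ :=
    hmean k ▸ hasSubgaussianMGF_of_mem_Icc (hφX k).aemeasurable (.of_forall fun ω => hmem _)
  have hcentred (k : ℕ) : ∫ ω, (φ (X k ω) - ∫ y, φ y ∂P) ∂μ = 0 := by
    rw [integral_sub (Integrable.of_mem_Icc a b (hφX k).aemeasurable (.of_forall fun ω => hmem _))
      (integrable_const _), hmean, integral_const, probReal_univ, one_smul, sub_self]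
  have hindep' : iIndepFun (fun j ω => φ (X (Nat.nth s j) ω) - ∫ y, φ y ∂P) μ :=
    (hindep.precomp (Nat.nth_injective (infinite_of_tendsto_count hs))).comp
      (fun _ y => φ y - ∫ y, φ y ∂P) fun _ => hφ.sub_const _
  filter_upwards [ae_isLittleO_sum_sqrt_mul_log
    (fun j => ((hφX (Nat.nth s j)).sub_const (∫ y, φ y ∂P)).stronglyMeasurable) hindep'
    (fun j => hsub _) fun j => hcentred _] with ω hω
  refine (hω.comp_tendsto hs).congr_left fun n => ?_
  exact sum_range_count_nth s (fun k => φ (X k ω) - ∫ y, φ y ∂P) n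

lemma ae_isLittleO_count_sub (hX : ∀ k, Measurable (X k)) (hlaw : ∀ k, μ.map (X k) = P)
    (hindep : iIndepFun X μ) {B : S → Prop} [DecidablePred B] (hB : MeasurableSet {y | B y})
    (hs : Tendsto (Nat.count s) atTop atTop) :
    ∀ᵐ ω ∂μ, (fun n => (Nat.count (fun k => s k ∧ B (X k ω)) n : ℝ) -
        Nat.count s n * P.real {y | B y}) =o[atTop]
      fun n => √(Nat.count s n * Real.log (Nat.count s n)) := by
  have hind (y : S) : ({y | B y}.indicator (fun _ => 1) y : ℝ) = if B y then 1 else 0 := by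
    simp only [Set.indicator, Set.mem_ofPred_eq]
  filter_upwards [ae_isLittleO_sum_filter_sub hX hlaw hindep
    (measurable_const.indicator hB) (a := 0) (b := 1)
    (fun y => by rw [hind]; split_ifs <;> norm_num) hs] with ω hω
  refine hω.congr_left fun n => ?_
  rw [integral_indicator_const _ hB, smul_eq_mul, mul_one]
  simp only [hind]
  rw [Finset.sum_sub_distrib, Finset.sum_boole, Finset.sum_const, nsmul_eq_mul,
    Finset.filter_filter, ← Nat.count_eq_card_filter_range, ← Nat.count_eq_card_filter_range]

end

lemma measurable_count {T : Type*} [MeasurableSpace T] {p : ℕ → T → Prop}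
    [∀ k z, Decidable (p k z)] (hp : ∀ k, MeasurableSet {z | p k z}) (n : ℕ) :
    Measurable fun z => Nat.count (fun k => p k z) n := by
  simp only [Nat.count_eq_card_filter_range, Finset.card_filter]
  exact Finset.measurable_fun_sum _ fun k _ => Measurable.ite (hp k) measurable_const
    measurable_const

lemma measurableSet_isLittleO {T : Type*} [MeasurableSpace T] {f g : ℕ → T → ℝ}
    (hf : ∀ n, Measurable (f n)) (hg : ∀ n, Measurable (g n)) :
    MeasurableSet {z | (fun n => f n z) =o[atTop] fun n => g n z} := by
  simp only [isLittleO_iff_nat_mul_le, eventually_atTop, Set.ofPred_forall, Set.ofPred_exists]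
  exact .iInter fun q => .iUnion fun N => .iInter fun n => .iInter fun _ =>
    measurableSet_le ((hf n).norm.const_mul _) (hg n).norm

lemma ae_isLittleO_count_sub_of_indepFun {F : Type*} [MeasurableSpace F] {M : ℕ → Ω → F}
    (hX : ∀ k, Measurable (X k)) (hlaw : ∀ k, μ.map (X k) = P) (hindep : iIndepFun X μ)
    (hM : ∀ k, Measurable (M k)) (hXM : IndepFun (fun ω k => X k ω) (fun ω k => M k ω) μ)
    {B : S → Prop} [DecidablePred B] (hB : MeasurableSet {y | B y})
    {D : F → Prop} [DecidablePred D] (hD : MeasurableSet {y | D y}) :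
    ∀ᵐ ω ∂μ, Tendsto (Nat.count fun k => D (M k ω)) atTop atTop →
      (fun n => (Nat.count (fun k => D (M k ω) ∧ B (X k ω)) n : ℝ) -
        Nat.count (fun k => D (M k ω)) n * P.real {y | B y}) =o[atTop]
      fun n => √(Nat.count (fun k => D (M k ω)) n *
        Real.log (Nat.count (fun k => D (M k ω)) n)) := by
  have hDm (k : ℕ) : MeasurableSet {z : (ℕ → F) × (ℕ → S) | D (z.1 k)} :=
    ((measurable_pi_apply k).comp measurable_fst) hD
  have hDB (k : ℕ) : MeasurableSet {z : (ℕ → F) × (ℕ → S) | D (z.1 k) ∧ B (z.2 k)} :=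
    (hDm k).inter (((measurable_pi_apply k).comp measurable_snd) hB)
  have hcast := measurable_of_countable (Nat.cast : ℕ → ℝ)
  have hgauge := measurable_of_countable fun N : ℕ => √(N * Real.log N)
  have hmeas : MeasurableSet {z : (ℕ → F) × (ℕ → S) |
      Tendsto (Nat.count fun k => D (z.1 k)) atTop atTop →
        (fun n => (Nat.count (fun k => D (z.1 k) ∧ B (z.2 k)) n : ℝ) -
          Nat.count (fun k => D (z.1 k)) n * P.real {y | B y}) =o[atTop]
        fun n => √(Nat.count (fun k => D (z.1 k)) n *
          Real.log (Nat.count (fun k => D (z.1 k)) n))} :=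
    (measurableSet_tendsto atTop (measurable_count hDm)).imp <| measurableSet_isLittleO
      (fun n => (hcast.comp (measurable_count hDB n)).sub
        ((hcast.comp (measurable_count hDm n)).mul_const _))
      fun n => hgauge.comp (measurable_count hDm n)
  refine ae_of_forall_ae_of_indepFun (measurable_pi_lambda _ hX).aemeasurable
    (measurable_pi_lambda _ hM).aemeasurable hXM hmeas fun m => ?_
  by_cases hs : Tendsto (Nat.count fun k => D (m k)) atTop atTop
  · filter_upwards [ae_isLittleO_count_sub hX hlaw hindep hB hs] with ω hω _ using hω
  · exact .of_forall fun ω h => (hs h).elim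

end Sampling

section Weights

variable {V : Type*} {A : V → Type*} [∀ i, DecidableEq (A i)]

/-- The contingency table of the entries `i` and `j` of the rows `x k`, `k < n`, in which both are
observed: the numerator of the empirical pair distribution that enters `weightK`. -/
def jointCount (x : ℕ → ∀ i, A i) (m : ℕ → V → Bool) (n : ℕ) (i j : V) (u : A i) (v : A j) : ℕ :=
  ((jointRows m n i j).filter fun k => x k i = u ∧ x k j = v).card

variable (x : ℕ → ∀ i, A i) (m : ℕ → V → Bool) (n : ℕ) (i j : V)

lemma card_jointRows_eq_count :
    (jointRows m n i j).card = Nat.count (fun k => m k i = true ∧ m k j = true) n := by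
  rw [jointRows, Nat.count_eq_card_filter_range]

lemma jointCount_eq_count (u : A i) (v : A j) : jointCount x m n i j u v =
    Nat.count (fun k => (m k i = true ∧ m k j = true) ∧ x k i = u ∧ x k j = v) n := by
  rw [jointCount, jointRows, Finset.filter_filter, Nat.count_eq_card_filter_range]

variable [∀ i, Fintype (A i)]

lemma sum_jointCount_right (u : A i) :
    ∑ v, jointCount x m n i j u v = ((jointRows m n i j).filter fun k => x k i = u).card := by
  rw [Finset.card_eq_sum_card_fiberwise (f := fun k => x k j) (t := Finset.univ) (by simp)]
  simp only [Finset.filter_filter, jointCount]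

lemma sum_jointCount_left (v : A j) :
    ∑ u, jointCount x m n i j u v = ((jointRows m n i j).filter fun k => x k j = v).card := by
  rw [Finset.card_eq_sum_card_fiberwise (f := fun k => x k i) (t := Finset.univ) (by simp)]
  simp only [Finset.filter_filter, jointCount, and_comm]

lemma sum_jointCount : ∑ u, ∑ v, jointCount x m n i j u v = (jointRows m n i j).card := by
  simp only [sum_jointCount_right]
  exact (Finset.card_eq_sum_card_fiberwise (f := fun k => x k i) (t := Finset.univ)
    (by simp)).symm

lemma weightK_eq_logBayesFactor_div (a : ∀ i, A i → ℝ) (b : ∀ i j, A i → A j → ℝ) :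
    weightK a b x m n i j =
      logBayesFactor (a i) (a j) (b i j) (jointCount x m n i j) / (jointRows m n i j).card := by
  have hrows : jointRows m n j i = jointRows m n i j := by
    simp only [jointRows, and_comm]
  rw [weightK, one_div, inv_mul_eq_div, logBayesFactor]
  simp only [sum_jointCount_right, sum_jointCount_left, bayesPair, bayesSingle, hrows]
  rfl

end Weights

section Consistency

open Asymptotics

variable {V : Type*} [Finite V] {A : V → Type*} [∀ i, MeasurableSpace (A i)]
  {Ω : Type*} [MeasurableSpace Ω] {μ : Measure Ω} {P : Measure (∀ i, A i)} {X : ℕ → Ω → ∀ i, A i}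

lemma ae_forall_real_singleton_ne_zero [∀ i, Finite (A i)] [IsFiniteMeasure P]
    (hX : ∀ k, Measurable (X k)) (hlaw : ∀ k, μ.map (X k) = P) :
    ∀ᵐ ω ∂μ, ∀ k, P.real {X k ω} ≠ 0 := by
  have hP : ∀ᵐ y ∂P, P.real {y} ≠ 0 :=
    ae_iff_of_countable.mpr fun y hy => (measureReal_ne_zero_iff).mpr hy
  exact ae_all_iff.mpr fun k =>
    ae_of_ae_map (p := fun y => P.real {y} ≠ 0) (hX k).aemeasurable ((hlaw k).symm ▸ hP)

variable [∀ i, MeasurableSingletonClass (A i)] [∀ i, DecidableEq (A i)] [IsProbabilityMeasure μ]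
  {M : ℕ → Ω → V → Bool}

lemma ae_isLittleO_jointCount_sub [∀ i, Finite (A i)] (hX : ∀ k, Measurable (X k))
    (hlaw : ∀ k, μ.map (X k) = P) (hindep : iIndepFun X μ) (hM : ∀ k, Measurable (M k))
    (hXM : IndepFun (fun ω k => X k ω) (fun ω k => M k ω) μ) {i j : V}
    (hn : ∀ᵐ ω ∂μ, Tendsto (fun n => (jointRows (fun k => M k ω) n i j).card) atTop atTop) :
    ∀ᵐ ω ∂μ, ∀ u v,
      (fun n => (jointCount (fun k => X k ω) (fun k => M k ω) n i j u v : ℝ) -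
        (jointRows (fun k => M k ω) n i j).card * pairMarginal P i j u v) =o[atTop]
      fun n => √((jointRows (fun k => M k ω) n i j).card *
        Real.log (jointRows (fun k => M k ω) n i j).card) := by
  have hdev := ae_all_iff.mpr fun u : A i => ae_all_iff.mpr fun v : A j =>
    ae_isLittleO_count_sub_of_indepFun hX hlaw hindep hM hXM
      (B := fun y => y i = u ∧ y j = v) (D := fun m => m i = true ∧ m j = true)
      (Set.toFinite _).measurableSet (Set.toFinite _).measurableSet
  filter_upwards [hdev, hn] with ω hω hN u v
  simp only [card_jointRows_eq_count, jointCount_eq_count] at hN ⊢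
  exact hω u v hN

variable [∀ i, Fintype (A i)] {a : ∀ i, A i → ℝ} {b : ∀ i j, A i → A j → ℝ} {i j : V}

lemma ae_tendsto_weightK [∀ i, Nonempty (A i)] (ha : ∀ i u, 0 < a i u)
    (hb : ∀ i j u v, 0 < b i j u v) (hX : ∀ k, Measurable (X k))
    (hlaw : ∀ k, μ.map (X k) = P) (hindep : iIndepFun X μ) (hM : ∀ k, Measurable (M k))
    (hXM : IndepFun (fun ω k => X k ω) (fun ω k => M k ω) μ)
    (hn : ∀ᵐ ω ∂μ, Tendsto (fun n => (jointRows (fun k => M k ω) n i j).card) atTop atTop) :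
    ∀ᵐ ω ∂μ, Tendsto (fun n => weightK a b (fun k => X k ω) (fun k => M k ω) n i j) atTop
      (nhds (mutualInfo P i j)) := by
  have : IsProbabilityMeasure P :=
    hlaw 0 ▸ Measure.isProbabilityMeasure_map (hX 0).aemeasurable
  filter_upwards [ae_isLittleO_jointCount_sub hX hlaw hindep hM hXM hn, hn] with ω hdev hN
  simp only [weightK_eq_logBayesFactor_div, mutualInfo_eq_tableInfo]
  exact tendsto_logBayesFactor_div (ha i) (ha j) (hb i j) (fun n => sum_jointCount _ _ n i j) hN
    fun u v => tendsto_div_of_isLittleO_sqrt hN (hdev u v)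

lemma ae_eventually_weightK_nonpos [∀ i, Nontrivial (A i)] (ha : ∀ i u, 0 < a i u)
    (hb : ∀ i j u v, 0 < b i j u v) (hX : ∀ k, Measurable (X k))
    (hlaw : ∀ k, μ.map (X k) = P) (hindep : iIndepFun X μ) (hM : ∀ k, Measurable (M k))
    (hXM : IndepFun (fun ω k => X k ω) (fun ω k => M k ω) μ)
    (ha' : ∀ i u, marginal P i u = 0 → a i u = 1 / 2)
    (hb' : ∀ i j u v, marginal P i u = 0 ∨ marginal P j v = 0 → b i j u v = 1 / 2)
    (hn : ∀ᵐ ω ∂μ, Tendsto (fun n => (jointRows (fun k => M k ω) n i j).card) atTop atTop)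
    (hI : mutualInfo P i j ≤ 0) :
    ∀ᵐ ω ∂μ, ∀ᶠ n in atTop,
      weightK a b (fun k => X k ω) (fun k => M k ω) n i j ≤ 0 := by
  have : IsProbabilityMeasure P :=
    hlaw 0 ▸ Measure.isProbabilityMeasure_map (hX 0).aemeasurable
  have hprod (u : A i) (v : A j) := pairMarginal_eq_mul_of_mutualInfo_nonpos P hI u v
  filter_upwards [ae_isLittleO_jointCount_sub hX hlaw hindep hM hXM hn, hn,
    ae_forall_real_singleton_ne_zero hX hlaw] with ω hdev hN hpos
  have hsupp (n : ℕ) (u : A i) (v : A j) (h : marginal P i u * marginal P j v = 0) :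
      jointCount (fun k => X k ω) (fun k => M k ω) n i j u v = 0 := by
    refine Finset.card_filter_eq_zero_iff.mpr ?_
    rintro k - ⟨rfl, rfl⟩
    exact (pairMarginal_pos P (hpos k) i j).ne' ((hprod _ _).trans h)
  simp only [hprod] at hdev
  filter_upwards [eventually_logBayesFactor_nonpos (ha i) (ha j) (hb i j)
    (fun n => sum_jointCount _ _ n i j) hN hdev (marginal_nonneg P i) (marginal_nonneg P j)
    (sum_marginal P i) (sum_marginal P j) hsupp (ha' i) (ha' j)
    fun u v h => hb' i j u v (mul_eq_zero.mp h)] with n hle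
  rw [weightK_eq_logBayesFactor_div]
  exact div_nonpos_of_nonpos_of_nonneg hle (Nat.cast_nonneg _)

end Consistency

end ForestLearning

theorem proposition5_general {V : Type*} [Fintype V] [DecidableEq V]
    {A : V → Type*} [∀ i, Fintype (A i)] [∀ i, DecidableEq (A i)] [∀ i, Nontrivial (A i)]
    [∀ i, MeasurableSpace (A i)] [∀ i, MeasurableSingletonClass (A i)]
    (a : ∀ i, A i → ℝ) (ha : ∀ i u, 0 < a i u)
    (b : ∀ i j, A i → A j → ℝ) (hb : ∀ i j u v, 0 < b i j u v)
    {Ω : Type*} [MeasurableSpace Ω] (μ : Measure Ω) [IsProbabilityMeasure μ]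
    (P : Measure (∀ i, A i))
    (X : ℕ → Ω → ∀ i, A i) (hX : ∀ k, Measurable (X k))
    (hX_law : ∀ k, μ.map (X k) = P) (hX_indep : iIndepFun X μ)
    (M : ℕ → Ω → V → Bool) (hM : ∀ k, Measurable (M k))
    (hXM : IndepFun (fun ω k => X k ω) (fun ω k => M k ω) μ)
    (ha' : ∀ i u, ForestLearning.marginal P i u = 0 → a i u = 1 / 2)
    (hb' : ∀ i j u v, ForestLearning.marginal P i u = 0 ∨ ForestLearning.marginal P j v = 0 →
      b i j u v = 1 / 2)
    (hn : ∀ i j, i ≠ j → ∀ᵐ ω ∂μ,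
      Tendsto (fun n => (ForestLearning.jointRows (fun k => M k ω) n i j).card) atTop atTop) :
    ∀ᵐ ω ∂μ, ∀ᶠ n in atTop,
      (∃ E, ForestLearning.IsChowLiuOutput
        (ForestLearning.weightK a b (fun k => X k ω) (fun k => M k ω) n) E) ∧
      ∀ E, ForestLearning.IsChowLiuOutput
          (ForestLearning.weightK a b (fun k => X k ω) (fun k => M k ω) n) E →
        ForestLearning.IsChowLiuOutput (ForestLearning.mutualInfo P) E ∧
        ((∃ T, ForestLearning.FactorsAlongForest P T) → ForestLearning.IsTrueForest P E) ∧
        ∀ T, (∀ T', ForestLearning.IsTrueForest P T' ↔ T' = T) → E = T := by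
  have htend := ae_all_iff.mpr fun i => ae_all_iff.mpr fun j => ae_all_iff.mpr fun hij : i ≠ j =>
    ForestLearning.ae_tendsto_weightK ha hb hX hX_law hX_indep hM hXM (hn i j hij)
  have hnonpos := ae_all_iff.mpr fun i => ae_all_iff.mpr fun j => ae_all_iff.mpr
    fun hij : i ≠ j => ae_all_iff.mpr fun hI : ForestLearning.mutualInfo P i j ≤ 0 =>
      ForestLearning.ae_eventually_weightK_nonpos ha hb hX hX_law hX_indep hM hXM ha' hb'
        (hn i j hij) hI
  have : IsProbabilityMeasure P :=
    hX_law 0 ▸ Measure.isProbabilityMeasure_map (hX 0).aemeasurable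
  filter_upwards [htend, hnonpos] with ω htend hnonpos
  filter_upwards [ForestLearning.eventually_isChowLiuOutput_of_tendsto htend hnonpos] with n hn
  refine ⟨ForestLearning.exists_isChowLiuOutput _, fun E hE => ?_⟩
  have htrue : (∃ T, ForestLearning.FactorsAlongForest P T) → ForestLearning.IsTrueForest P E :=
    fun ⟨_, hT⟩ => ForestLearning.isTrueForest_of_isChowLiuOutput P hT (hn E hE)
  exact ⟨hn E hE, htrue, fun T hT => (hT E).mp (htrue ⟨T, ((hT T).mpr rfl).prop⟩)⟩

theorem proposition5 {V : Type*} [Fintype V] [DecidableEq V]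
    {A : V → Type*} [∀ i, Fintype (A i)] [∀ i, DecidableEq (A i)] [∀ i, Nontrivial (A i)]
    [∀ i, MeasurableSpace (A i)] [∀ i, MeasurableSingletonClass (A i)]
    (a : ∀ i, A i → ℝ) (ha : ∀ i u, 0 < a i u)
    (b : ∀ i j, A i → A j → ℝ) (hb : ∀ i j u v, 0 < b i j u v)
    (hb_symm : ∀ i j u v, b i j u v = b j i v u)
    {Ω : Type*} [MeasurableSpace Ω] (μ : Measure Ω) [IsProbabilityMeasure μ]
    (P : Measure (∀ i, A i))
    (X : ℕ → Ω → ∀ i, A i) (hX : ∀ k, Measurable (X k))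
    (hX_law : ∀ k, μ.map (X k) = P) (hX_indep : iIndepFun X μ)
    (M : ℕ → Ω → V → Bool) (hM : ∀ k, Measurable (M k))
    (hXM : IndepFun (fun ω k => X k ω) (fun ω k => M k ω) μ)
    (hprior : (∀ i u, 0 < ForestLearning.marginal P i u) ∨
      ((∀ i u, a i u = 1 / 2) ∧ ∀ i j u v, b i j u v = 1 / 2))
    (hn : ∀ i j, i ≠ j → ∀ᵐ ω ∂μ,
      Tendsto (fun n => (ForestLearning.jointRows (fun k => M k ω) n i j).card) atTop atTop) :
    ∀ᵐ ω ∂μ, ∀ᶠ n in atTop,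
      (∃ E, ForestLearning.IsChowLiuOutput
        (ForestLearning.weightK a b (fun k => X k ω) (fun k => M k ω) n) E) ∧
      ∀ E, ForestLearning.IsChowLiuOutput
          (ForestLearning.weightK a b (fun k => X k ω) (fun k => M k ω) n) E →
        ForestLearning.IsChowLiuOutput (ForestLearning.mutualInfo P) E ∧
        ((∃ T, ForestLearning.FactorsAlongForest P T) → ForestLearning.IsTrueForest P E) ∧
        ∀ T, (∀ T', ForestLearning.IsTrueForest P T' ↔ T' = T) → E = T := by
  exact proposition5_general a ha b hb μ P X hX hX_law hX_indep M hM hXM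
    (fun i u h => hprior.elim (fun hpos => absurd h (hpos i u).ne') fun hhalf => hhalf.1 i u)
    (fun i j u v h => hprior.elim
      (fun hpos => (h.elim (hpos i u).ne' (hpos j v).ne').elim) fun hhalf => hhalf.2 i j u v) hn
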